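/- **Setting.** Let $p,n\ge 1$. Let $\sigma$ (activation of the discriminators) and $\varsigma$ (function fixing a scale) each be one of the functions $\mathbb I\{x\ge 1\}$, $\frac1{1+e^{-x}}$, $\max(\min(x+\frac12,1),0)$; in particular $\varsigma=\sigma$ is allowed. For a constant $0<a<\frac14$ let $$\mathcal H_a=\Big\{h:\mathbb R\to[0,\infty):\ h(t)=h(-t),\ \int h=1,\ \int \varsigma(t)(1-\varsigma(t))h(t)\,dt=a\Big\}.$$ For $\theta\in\mathbb R^p$, a positive semi-definite $\Sigma\in\mathbb R^{p\times p}$ and $h\in\mathcal H_a$, the elliptical distribution $EC(\theta,\Sigma,h)$ is the law of $\theta+\xi AU$, where $AA^T=\Sigma$, $U$ is uniform on the unit sphere of $\mathbb R^p$, $\xi\ge 0$ is independent of $U$, and for every unit vector $v$ the variable $\xi v^TU$ has density $h$ (only those $h$ for which such a $\xi$ exists are used; no moment is assumed, so the Cauchy distribution is included). Let $\mathcal E_p(M)$ be the set of positive semi-definite $p\times p$ matrices with spectral norm at most $M$, and for $\kappa>0$ let $$\mathcal D=\Big\{D(x)=\mathsf{sigmoid}\Big(\sum_{j=1}^N w_j\sigma(u_j^Tx+b_j)\Big):\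 N\ge 0,\ \sum_{j=1}^N|w_j|\le\kappa,\ u_j\in\mathbb R^p,\ b_j\in\mathbb R\Big\}.$$ Given observations $X_1,\dots,X_n\in\mathbb R^p$, put $$F_n(\eta,\Gamma,g)=\sup_{D\in\mathcal D}\Big[\frac1n\sum_{i=1}^n\log D(X_i)+E_{EC(\eta,\Gamma,g)}\log(1-D(X))\Big]+\log 4 .$$ The JS-GAN estimator $(\widehat\theta,\widehat\Sigma,\widehat h)$ is any minimizer of $F_n$ over $\eta\in\mathbb R^p$, $\Gamma\in\mathcal E_p(M)$, $g\in\mathcal H_a$, or more generally any point of this set with $F_n(\widehat\theta,\widehat\Sigma,\widehat h)\le F_n(\eta,\Gamma,g)+\tau$ for all such $(\eta,\Gamma,g)$, where $\tau\ge0$ is an optimization error; $\tau=0$ gives the exact minimizers. **Theorem.** For all constants $0<a<\frac14$ and $M,K>0$ there are constants $c,C,C'>0$, depending only on $a,M,K$ (and on the choice of $\sigma,\varsigma$), such that the following holds for all $n,p\ge1$ and $\epsilon\in[0,1]$ with $\frac pn+\epsilon^2\le c$, all $0<\kappa\le K(\sqrt{p/n}+\epsilon)$, all $0\le\tau\le K\kappa(\sqrt{p/n}+\epsilon)$,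 all $\theta\in\mathbb R^p$, $\Sigma\in\mathcal E_p(M)$, $h\in\mathcal H_a$ for which $EC(\theta,\Sigma,h)$ exists, and all probability distributions $Q$ on $\mathbb R^p$. If $X_1,\dots,X_n$ are i.i.d. from $(1-\epsilon)EC(\theta,\Sigma,h)+\epsilon Q$, then with probability at least $1-e^{-C'(p+n\epsilon^2)}$ every such estimator satisfies $$\|\widehat\theta-\theta\|^2\le C\Big(\frac pn\vee\epsilon^2\Big).$$ -/

import Mathlib

open MeasureTheory

/-- The activation functions allowed in the hidden layer. -/
inductive Activation where
  | indicator
  | sigmoid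
  | ramp

/-- The activation functions `𝕀{x ≥ 1}`, `1 / (1 + e⁻ˣ)` and `max (min (x + 1/2) 1) 0`. -/
noncomputable def Activation.fn : Activation → ℝ → ℝ
  | .indicator => Set.indicator (Set.Ici 1) 1
  | .sigmoid => Real.sigmoid
  | .ramp => fun x => max (min (x + 1 / 2) 1) 0

/-- The uniform probability distribution on the unit sphere of `ℝᵖ`: the surface measure
divided by its total mass. -/
noncomputable def uniformSphere (p : ℕ) :
    Measure (Metric.sphere (0 : EuclideanSpace ℝ (Fin p)) 1) :=
  ((volume : Measure (EuclideanSpace ℝ (Fin p))).toSphere Set.univ)⁻¹ •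
    (volume : Measure (EuclideanSpace ℝ (Fin p))).toSphere

/-- The class of symmetric probability densities `h` on `ℝ`, with scale fixed by
`∫ ς(t) (1 - ς(t)) h(t) dt = a`.  (`∫ h = 1` includes integrability of `h`.) -/
def densityClass (ς : ℝ → ℝ) (a : ℝ) : Set (ℝ → ℝ) :=
  {h | (∀ t, h t = h (-t)) ∧ (∀ t, 0 ≤ h t) ∧ ∫ t, h t = 1 ∧
    ∫ t, ς t * (1 - ς t) * h t = a}

/-- The positive semi-definite `p × p` matrices whose spectral norm is at most `M`. -/
def scatterClass (p : ℕ) (M : ℝ) : Set (Matrix (Fin p) (Fin p) ℝ) :=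
  {S | S.PosSemidef ∧ ‖Matrix.toEuclideanCLM (n := Fin p) (𝕜 := ℝ) S‖ ≤ M}

/-- `P` is the elliptical distribution `EC(θ, S, h)`: the law of `θ + ξ A U`, where `A Aᵀ = S`,
`U` is uniform on the unit sphere, `ξ ≥ 0` (with law `ν`) is independent of `U`, and `h` is the
density of `ξ vᵀU` for every unit vector `v`. -/
def IsElliptical {p : ℕ} (θ : EuclideanSpace ℝ (Fin p)) (S : Matrix (Fin p) (Fin p) ℝ)
    (h : ℝ → ℝ) (P : Measure (EuclideanSpace ℝ (Fin p))) : Prop :=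
  ∃ (A : Matrix (Fin p) (Fin p) ℝ) (ν : Measure ℝ),
    A * A.transpose = S ∧ IsProbabilityMeasure ν ∧ (∀ᵐ r ∂ν, 0 ≤ r) ∧
    (∀ v : EuclideanSpace ℝ (Fin p), ‖v‖ = 1 →
      (ν.prod (uniformSphere p)).map (fun q => q.1 * inner ℝ v q.2.1) =
        volume.withDensity (fun t => ENNReal.ofReal (h t))) ∧
    P = (ν.prod (uniformSphere p)).map
      (fun q => θ + q.1 • Matrix.toEuclideanCLM (n := Fin p) (𝕜 := ℝ) A q.2.1)

/-- The discriminators `D(x) = sigmoid (∑ⱼ wⱼ σ(uⱼᵀx + bⱼ))` with one hidden layer, of arbitrary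
width `N`, and `∑ⱼ |wⱼ| ≤ κ`. -/
def discriminatorClass (p : ℕ) (σ : ℝ → ℝ) (κ : ℝ) : Set (EuclideanSpace ℝ (Fin p) → ℝ) :=
  {D | ∃ (N : ℕ) (w : Fin N → ℝ) (u : Fin N → EuclideanSpace ℝ (Fin p)) (b : Fin N → ℝ),
    ∑ j, |w j| ≤ κ ∧
    D = fun x => Real.sigmoid (∑ j, w j * σ (inner ℝ (u j) x + b j))}

/-- The JS-GAN criterion
`sup_D [n⁻¹ ∑ᵢ log D(xᵢ) + E_P log (1 - D(X))] + log 4`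
of a sample `x` and a generator distribution `P`. -/
noncomputable def jsCriterion {n p : ℕ} (σ : ℝ → ℝ) (κ : ℝ)
    (x : Fin n → EuclideanSpace ℝ (Fin p)) (P : Measure (EuclideanSpace ℝ (Fin p))) : ℝ :=
  sSup ((fun D : EuclideanSpace ℝ (Fin p) → ℝ =>
      (1 / (n : ℝ)) * ∑ i, Real.log (D (x i)) + ∫ y, Real.log (1 - D y) ∂P) ''
    discriminatorClass p σ κ) + Real.log 4

/-- `θhat` is the location component of a triple `(θhat, Shat, hhat)` which minimizes, up to an
additive error `τ` (exactly, if `τ = 0`), the JS-GAN criterion of the sample `x` over all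
elliptical distributions `EC(η, Γ, g)` with `Γ` in the scatter class and `g` in the density
class. -/
def IsJSGANEstimate {n p : ℕ} (σ ς : ℝ → ℝ) (a M κ τ : ℝ)
    (x : Fin n → EuclideanSpace ℝ (Fin p)) (θhat : EuclideanSpace ℝ (Fin p)) : Prop :=
  ∃ Shat ∈ scatterClass p M, ∃ hhat ∈ densityClass ς a,
    ∃ Phat : Measure (EuclideanSpace ℝ (Fin p)), IsElliptical θhat Shat hhat Phat ∧
      ∀ η : EuclideanSpace ℝ (Fin p), ∀ Γ ∈ scatterClass p M, ∀ g ∈ densityClass ς a,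
        ∀ P : Measure (EuclideanSpace ℝ (Fin p)), IsElliptical η Γ g P →
          jsCriterion σ κ x Phat ≤ jsCriterion σ κ x P + τ

/-- Huber's contamination model `(1 - ε) P + ε Q`. -/
noncomputable def contaminate {E : Type*} [MeasurableSpace E] (ε : ℝ) (P Q : Measure E) :
    Measure E :=
  ENNReal.ofReal (1 - ε) • P + ENNReal.ofReal ε • Q

/-- The value `±1` of a random sign encoded by a Boolean. -/
def boolSign (b : Bool) : ℝ := if b then 1 else -1

lemma sum_exp_sum_boolSign {ι : Type*} [Fintype ι] [DecidableEq ι] (c : ι → ℝ) :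
    ∑ ε : ι → Bool, Real.exp (∑ i, c i * boolSign (ε i)) = ∏ i, (2 * Real.cosh (c i)) := by
  have h := Finset.prod_univ_sum (fun _ : ι => (Finset.univ : Finset Bool))
    (fun i b => Real.exp (c i * boolSign b))
  rw [Fintype.piFinset_univ] at h
  simp only [Real.exp_sum]
  rw [← h]
  refine Finset.prod_congr rfl fun i _ => ?_
  rw [Fintype.sum_bool, Real.cosh_eq]
  simp only [boolSign, if_true, Bool.false_eq_true, if_false, mul_one, mul_neg]
  ring

lemma sum_exp_sum_boolSign_le {n : ℕ} (c : Fin n → ℝ) {V : ℝ} (hV : ∑ i, c i ^ 2 ≤ V) :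
    ∑ ε : Fin n → Bool, Real.exp (∑ i, c i * boolSign (ε i)) ≤ 2 ^ n * Real.exp (V / 2) := by
  rw [sum_exp_sum_boolSign, Finset.prod_mul_distrib]
  simp only [Finset.prod_const, Finset.card_univ, Fintype.card_fin]
  refine mul_le_mul_of_nonneg_left ?_ (by positivity)
  calc ∏ i, Real.cosh (c i) ≤ ∏ i, Real.exp (c i ^ 2 / 2) :=
        Finset.prod_le_prod (fun i _ => (Real.cosh_pos _).le)
          fun i _ => Real.cosh_le_exp_half_sq _
    _ = Real.exp ((∑ i, c i ^ 2) / 2) := by rw [← Real.exp_sum, Finset.sum_div]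
    _ ≤ _ := by gcongr

lemma card_lt_sum_boolSign_le {n : ℕ} (c : Fin n → ℝ) {V a : ℝ} (hV : ∑ i, c i ^ 2 ≤ V)
    (hV₀ : 0 < V) (ha : 0 ≤ a) :
    ((Finset.univ.filter fun ε : Fin n → Bool => a < ∑ i, c i * boolSign (ε i)).card : ℝ) ≤
      2 ^ n * Real.exp (-(a ^ 2 / (2 * V))) := by
  have h1 : ∑ i, (a / V * c i) ^ 2 ≤ a ^ 2 / V := by
    simp only [mul_pow]
    rw [← Finset.mul_sum]
    calc (a / V) ^ 2 * ∑ i, c i ^ 2 ≤ (a / V) ^ 2 * V := by gcongr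
      _ = a ^ 2 / V := by field_simp
  have h2 := sum_exp_sum_boolSign_le _ h1
  have h3 : ((Finset.univ.filter fun ε : Fin n → Bool =>
      a < ∑ i, c i * boolSign (ε i)).card : ℝ) * Real.exp (a ^ 2 / V) ≤
      ∑ ε : Fin n → Bool, Real.exp (∑ i, a / V * c i * boolSign (ε i)) := by
    rw [← nsmul_eq_mul]
    refine le_trans (Finset.card_nsmul_le_sum _ (fun ε : Fin n → Bool =>
      Real.exp (∑ i, a / V * c i * boolSign (ε i))) _ fun ε hε => ?_)
      (Finset.sum_le_sum_of_subset_of_nonneg (Finset.filter_subset _ _)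
        fun _ _ _ => (Real.exp_pos _).le)
    rw [Finset.mem_filter] at hε
    refine Real.exp_le_exp.2 ?_
    simp only [mul_assoc]
    rw [← Finset.mul_sum]
    calc a ^ 2 / V = a / V * a := by ring
      _ ≤ _ := mul_le_mul_of_nonneg_left hε.2.le (by positivity)
  have h4 : (2 : ℝ) ^ n * Real.exp (-(a ^ 2 / (2 * V))) * Real.exp (a ^ 2 / V) =
      2 ^ n * Real.exp (a ^ 2 / V / 2) := by
    rw [mul_assoc, ← Real.exp_add]
    congr 2
    field_simp
    ring
  exact le_of_mul_le_mul_right ((h3.trans h2).trans_eq h4.symm) (Real.exp_pos _)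

lemma card_lt_abs_sum_boolSign_le {n : ℕ} (c : Fin n → ℝ) {V a : ℝ} (hV : ∑ i, c i ^ 2 ≤ V)
    (hV₀ : 0 < V) (ha : 0 ≤ a) :
    ((Finset.univ.filter fun ε : Fin n → Bool => a < |∑ i, c i * boolSign (ε i)|).card : ℝ) ≤
      2 ^ n * (2 * Real.exp (-(a ^ 2 / (2 * V)))) := by
  have h1 := card_lt_sum_boolSign_le c hV hV₀ ha
  have h2 := card_lt_sum_boolSign_le (fun i => -c i) (by simpa using hV) hV₀ ha
  have h3 : (Finset.univ.filter fun ε : Fin n → Bool => a < |∑ i, c i * boolSign (ε i)|) ⊆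
      (Finset.univ.filter fun ε : Fin n → Bool => a < ∑ i, c i * boolSign (ε i)) ∪
      (Finset.univ.filter fun ε : Fin n → Bool => a < ∑ i, -c i * boolSign (ε i)) := by
    intro ε
    simp only [Finset.mem_filter, Finset.mem_union, Finset.mem_univ, true_and, lt_abs, neg_mul,
      Finset.sum_neg_distrib]
    exact id
  have h4 := (Finset.card_le_card h3).trans (Finset.card_union_le _ _)
  have h5 := (Nat.cast_le (α := ℝ)).2 h4
  push_cast at h5
  linarith

/-- The family `𝒞` of sets picks out at most `∑_{i ≤ d} (m choose i)` subsets of any `m` points. -/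
def HasPolynomialGrowth {E : Type*} (𝒞 : Set (Set E)) (d : ℕ) : Prop :=
  ∀ (m : ℕ) (y : Fin m → E) (T : Finset (Finset (Fin m))),
    (∀ S ∈ T, ∃ A ∈ 𝒞, ∀ i, i ∈ S ↔ y i ∈ A) → T.card ≤ ∑ i ∈ Finset.range (d + 1), m.choose i

lemma sum_range_choose_le_exp (m d : ℕ) {x : ℝ} (hx : 0 < x) (hx₁ : x ≤ 1) :
    ((∑ i ∈ Finset.range (d + 1), m.choose i : ℕ) : ℝ) ≤ (1 / x) ^ d * Real.exp (x * m) := by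
  have h1 : ∑ i ∈ Finset.range (d + 1), (m.choose i : ℝ) * x ^ i ≤ (x + 1) ^ m := by
    rw [add_pow]
    simp only [one_pow, mul_one]
    have : ∀ i, (m.choose i : ℝ) * x ^ i = x ^ i * m.choose i := fun i => mul_comm _ _
    simp only [this]
    rcases le_total (d + 1) (m + 1) with h | h
    · exact Finset.sum_le_sum_of_subset_of_nonneg (Finset.range_mono h)
        fun _ _ _ => by positivity
    · refine (Finset.sum_subset (Finset.range_mono h) fun i _ hi => ?_).ge
      rw [Finset.mem_range, not_lt] at hi
      rw [Nat.choose_eq_zero_of_lt (by omega)]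
      simp
  have h2 : (x + 1) ^ m ≤ Real.exp (x * m) := by
    rw [mul_comm, Real.exp_nat_mul]
    exact pow_le_pow_left₀ (by positivity) (Real.add_one_le_exp x) _
  calc ((∑ i ∈ Finset.range (d + 1), m.choose i : ℕ) : ℝ)
      = (1 / x) ^ d * ∑ i ∈ Finset.range (d + 1), (m.choose i : ℝ) * x ^ d := by
        rw [← Finset.sum_mul, mul_comm, mul_assoc, ← mul_pow, mul_one_div_cancel hx.ne']
        push_cast
        ring
    _ ≤ (1 / x) ^ d * ∑ i ∈ Finset.range (d + 1), (m.choose i : ℝ) * x ^ i := by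
        refine mul_le_mul_of_nonneg_left (Finset.sum_le_sum fun i hi => ?_) (by positivity)
        refine mul_le_mul_of_nonneg_left ?_ (by positivity)
        exact pow_le_pow_of_le_one hx.le hx₁ (by rw [Finset.mem_range] at hi; omega)
    _ ≤ _ := mul_le_mul_of_nonneg_left (h1.trans h2) (by positivity)

/-- A random sample of `m` points separates all members of a family of well separated sets. -/
lemma exists_separating_sample {n : ℕ} (T : Finset (Finset (Fin n))) {ρ : ℝ} (m : ℕ)
    (hsep : ∀ A ∈ T, ∀ B ∈ T, A ≠ B → ρ * n < (symmDiff A B).card)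
    (hm : Real.exp (-(ρ * m)) * (T.card : ℝ) ^ 2 ≤ 1) (hT : 2 ≤ T.card) :
    ∃ φ : Fin m → Fin n, ∀ A ∈ T, ∀ B ∈ T, A ≠ B → ∃ k, φ k ∈ symmDiff A B := by
  classical
  have hn : 0 < n := by
    rcases Nat.eq_zero_or_pos n with rfl | h
    · have := Finset.card_le_univ T
      simp at this
      omega
    · exact h
  by_contra! hcon
  have h1 : (Finset.univ : Finset (Fin m → Fin n)) ⊆
      T.offDiag.biUnion fun q => Fintype.piFinset fun _ => (symmDiff q.1 q.2)ᶜ := by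
    intro φ _
    obtain ⟨A, hA, B, hB, hAB, h⟩ := hcon φ
    rw [Finset.mem_biUnion]
    exact ⟨(A, B), by simp [hA, hB, hAB], by
      simpa only [Fintype.mem_piFinset, Finset.mem_compl] using h⟩
  have h2 := (Finset.card_le_card h1).trans Finset.card_biUnion_le
  have h3 : ∀ q ∈ T.offDiag, ((Fintype.piFinset fun _ : Fin m =>
      (symmDiff q.1 q.2)ᶜ).card : ℝ) ≤ n ^ m * Real.exp (-(ρ * m)) := by
    intro q hq
    rw [Finset.mem_offDiag] at hq
    have h4 := hsep _ hq.1 _ hq.2.1 hq.2.2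
    have h5 : ((symmDiff q.1 q.2)ᶜ.card : ℝ) ≤ n * Real.exp (-ρ) := by
      have h6 := Finset.card_add_card_compl (symmDiff q.1 q.2)
      rw [Fintype.card_fin] at h6
      have h7 : ((symmDiff q.1 q.2).card : ℝ) + ((symmDiff q.1 q.2)ᶜ.card : ℝ) = n := by
        exact_mod_cast h6
      have h8 := Real.add_one_le_exp (-ρ)
      have : (0 : ℝ) < n := by exact_mod_cast hn
      nlinarith
    rw [Fintype.card_piFinset_const]
    push_cast
    calc ((symmDiff q.1 q.2)ᶜ.card : ℝ) ^ m ≤ (n * Real.exp (-ρ)) ^ m := by gcongr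
      _ = _ := by rw [mul_pow, ← Real.exp_nat_mul]; congr 2; ring
  have h4 : ((Finset.univ : Finset (Fin m → Fin n)).card : ℝ) ≤
      T.offDiag.card * (n ^ m * Real.exp (-(ρ * m))) := by
    rw [← nsmul_eq_mul]
    refine le_trans ?_ (Finset.sum_le_card_nsmul _ _ _ h3)
    exact_mod_cast h2
  rw [Finset.offDiag_card, Nat.cast_sub (Nat.le_mul_self _)] at h4
  simp only [Finset.card_univ, Fintype.card_fun, Fintype.card_fin, Nat.cast_pow,
    Nat.cast_mul] at h4
  have h5 : (0 : ℝ) < (n : ℝ) ^ m := by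
    have : (0 : ℝ) < n := by exact_mod_cast hn
    positivity
  have h6 : (2 : ℝ) ≤ T.card := by exact_mod_cast hT
  have h7 := Real.exp_pos (-(ρ * m))
  have h8 : (1 : ℝ) ≤ (T.card * T.card - T.card) * Real.exp (-(ρ * m)) := by
    refine le_of_mul_le_mul_right ?_ h5
    linarith
  nlinarith

lemma log_card_le_of_separated {E : Type*} {𝒞 : Set (Set E)} {d n : ℕ}
    (h𝒞 : HasPolynomialGrowth 𝒞 d) (y : Fin n → E) (T : Finset (Finset (Fin n)))
    (hT : ∀ S ∈ T, ∃ A ∈ 𝒞, ∀ i, i ∈ S ↔ y i ∈ A) {ρ : ℝ} (hρ : 0 < ρ) (hρ₁ : ρ ≤ 1)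
    (hsep : ∀ A ∈ T, ∀ B ∈ T, A ≠ B → ρ * n < (symmDiff A B).card) :
    Real.log T.card ≤ 2 * d * Real.log (4 / ρ) + 1 := by
  classical
  have hlog : 0 ≤ Real.log (4 / ρ) := Real.log_nonneg (by rw [le_div_iff₀ hρ]; linarith)
  rcases Nat.lt_or_ge T.card 2 with h | hT2
  · have : Real.log T.card = 0 := by interval_cases T.card <;> simp
    rw [this]
    positivity
  have hN : (2 : ℝ) ≤ T.card := by exact_mod_cast hT2
  have hN0 : 0 < Real.log T.card := Real.log_pos (by linarith)
  set m := ⌈2 * Real.log T.card / ρ⌉₊ with hmdef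
  have hm1 : 2 * Real.log T.card ≤ ρ * m := by
    have := Nat.le_ceil (2 * Real.log T.card / ρ)
    rw [div_le_iff₀ hρ] at this
    linarith
  have hm2 : ρ * m ≤ 2 * Real.log T.card + ρ := by
    have := (Nat.ceil_lt_add_one (a := 2 * Real.log T.card / ρ) (by positivity)).le
    calc ρ * m ≤ ρ * (2 * Real.log T.card / ρ + 1) := by gcongr
      _ = _ := by field_simp
  obtain ⟨φ, hφ⟩ := exists_separating_sample T m hsep (by
    rw [show (T.card : ℝ) ^ 2 = Real.exp (2 * Real.log T.card) by
      rw [two_mul, Real.exp_add, Real.exp_log (by linarith)]; ring, ← Real.exp_add]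
    exact Real.exp_le_one_iff.2 (by linarith)) hT2
  have hcard : (T.image fun A => Finset.univ.filter fun k => φ k ∈ A).card = T.card := by
    refine Finset.card_image_of_injOn fun A hA B hB hAB => ?_
    by_contra hne
    obtain ⟨k, hk⟩ := hφ A hA B hB hne
    have h1 := congrArg (fun S => k ∈ S) hAB
    simp only [Finset.mem_filter, Finset.mem_univ, true_and, eq_iff_iff] at h1
    rw [Finset.mem_symmDiff] at hk
    tauto
  have h1 := h𝒞 m (y ∘ φ) (T.image fun A => Finset.univ.filter fun k => φ k ∈ A) (by
    intro S hS
    obtain ⟨A, hA, rfl⟩ := Finset.mem_image.1 hS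
    obtain ⟨C, hC, h⟩ := hT A hA
    exact ⟨C, hC, fun i => by simp [h]⟩)
  rw [hcard] at h1
  have h2 : (T.card : ℝ) ≤ (1 / (ρ / 4)) ^ d * Real.exp (ρ / 4 * m) :=
    le_trans (by exact_mod_cast h1) (sum_range_choose_le_exp m d (by positivity) (by linarith))
  have h3 := Real.log_le_log (by linarith) h2
  rw [one_div_div, Real.log_mul (by positivity) (Real.exp_pos _).ne', Real.log_pow,
    Real.log_exp] at h3
  linarith

/-- Every family of sets has a separated net. -/
lemma exists_separated_net {n : ℕ} (𝒜 : Finset (Finset (Fin n))) (r : ℝ) :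
    ∃ T ⊆ 𝒜, (∀ A ∈ T, ∀ B ∈ T, A ≠ B → r < (symmDiff A B).card) ∧
      ∀ A ∈ 𝒜, ∃ B ∈ T, A = B ∨ ((symmDiff A B).card : ℝ) ≤ r := by
  classical
  have hne : (𝒜.powerset.filter fun T => ∀ A ∈ T, ∀ B ∈ T, A ≠ B →
      r < ((symmDiff A B).card : ℝ)).Nonempty := ⟨∅, by simp⟩
  obtain ⟨T, hT, hmax⟩ := Finset.exists_max_image _ Finset.card hne
  simp only [Finset.mem_filter, Finset.mem_powerset] at hT hmax
  refine ⟨T, hT.1, hT.2, fun A hA => ?_⟩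
  by_contra! hcon
  have hAT : A ∉ T := fun h => (hcon A h).1 rfl
  have h1 := hmax (insert A T) ⟨Finset.insert_subset hA hT.1, fun B hB C hC hBC => by
    rw [Finset.mem_insert] at hB hC
    rcases hB with rfl | hB <;> rcases hC with rfl | hC
    · exact absurd rfl hBC
    · exact (hcon C hC).2
    · rw [symmDiff_comm]; exact (hcon B hB).2
    · exact hT.2 B hB C hC hBC⟩
  rw [Finset.card_insert_of_notMem hAT] at h1
  omega

lemma exists_net_of_growth {E : Type*} {𝒞 : Set (Set E)} {d n : ℕ}
    (h𝒞 : HasPolynomialGrowth 𝒞 d) (y : Fin n → E) (𝒜 : Finset (Finset (Fin n)))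
    (h𝒜 : ∀ S ∈ 𝒜, ∃ A ∈ 𝒞, ∀ i, i ∈ S ↔ y i ∈ A) {q : ℝ} (hq : 1 ≤ q) (hdq : d ≤ q) (j : ℕ) :
    ∃ T : Finset (Finset (Fin n)), (T.card : ℝ) ≤ Real.exp (6 * q * (j + 1)) ∧
      ∀ A ∈ 𝒜, ∃ B ∈ T, ((symmDiff A B).card : ℝ) ≤ n / 16 ^ j := by
  obtain ⟨T, hT𝒜, hsep, hcov⟩ := exists_separated_net 𝒜 ((1 / 16 ^ j : ℝ) * n)
  have h16 : (1 : ℝ) ≤ 16 ^ j := one_le_pow₀ (by norm_num)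
  refine ⟨T, ?_, fun A hA => ?_⟩
  · have h1 := log_card_le_of_separated h𝒞 y T (fun S hS => h𝒜 S (hT𝒜 hS))
      (by positivity : (0 : ℝ) < 1 / 16 ^ j) (by rw [div_le_one (by positivity)]; exact h16) hsep
    have h2 : Real.log (4 / (1 / 16 ^ j)) = (1 + 2 * j) * (2 * Real.log 2) := by
      rw [show (4 : ℝ) / (1 / 16 ^ j) = 2 ^ (2 + 4 * j) by
        rw [pow_add, pow_mul]; norm_num, Real.log_pow]
      push_cast
      ring
    have h3 := Real.log_two_lt_d9
    have h4 : (0 : ℝ) ≤ j := Nat.cast_nonneg j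
    have h5 : (0 : ℝ) ≤ d := Nat.cast_nonneg d
    have h6 : Real.log T.card ≤ 6 * q * (j + 1) := by
      rw [h2] at h1
      have h7 : (1 + 2 * (j : ℝ)) * (2 * Real.log 2) ≤ (1 + 2 * j) * 1.4 := by
        refine mul_le_mul_of_nonneg_left (by linarith) (by positivity)
      have h8 : 2 * (d : ℝ) * ((1 + 2 * (j : ℝ)) * (2 * Real.log 2)) ≤
          2 * q * ((1 + 2 * j) * 1.4) := by
        refine mul_le_mul (by linarith) h7 ?_ (by linarith)
        have := Real.log_nonneg (by norm_num : (1 : ℝ) ≤ 2)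
        positivity
      nlinarith
    rcases Nat.eq_zero_or_pos T.card with h | h
    · rw [h]; simp only [Nat.cast_zero]; exact (Real.exp_pos _).le
    · rwa [← Real.log_le_iff_le_exp (by exact_mod_cast h)]
  · obtain ⟨B, hB, h⟩ := hcov A hA
    refine ⟨B, hB, ?_⟩
    rcases h with rfl | h
    · simp only [symmDiff_self, Finset.bot_eq_empty, Finset.card_empty, Nat.cast_zero]
      positivity
    · rwa [one_div, inv_mul_eq_div] at h

/-- The sum of the signs over a set of indices. -/
noncomputable def signSum {n : ℕ} (A : Finset (Fin n)) (ε : Fin n → Bool) : ℝ :=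
  ∑ i, (if i ∈ A then 1 else 0) * boolSign (ε i)

lemma card_lt_abs_signSum_sub_le {n : ℕ} (A B : Finset (Fin n)) {V a : ℝ}
    (hV : ((symmDiff A B).card : ℝ) ≤ V) (hV₀ : 0 < V) (ha : 0 ≤ a) :
    ((Finset.univ.filter fun ε => a < |signSum A ε - signSum B ε|).card : ℝ) ≤
      2 ^ n * (2 * Real.exp (-(a ^ 2 / (2 * V)))) := by
  have h := card_lt_abs_sum_boolSign_le
    (fun i => (if i ∈ A then (1 : ℝ) else 0) - if i ∈ B then 1 else 0) (V := V) (a := a) (by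
      refine le_trans (le_of_eq ?_) hV
      rw [Finset.card_eq_sum_ones, Nat.cast_sum, ← Finset.sum_filter_add_sum_filter_not
        Finset.univ (fun i => i ∈ symmDiff A B)]
      rw [Finset.filter_mem_eq_inter, Finset.univ_inter]
      have h1 : ∀ i ∈ symmDiff A B,
          ((if i ∈ A then (1 : ℝ) else 0) - if i ∈ B then 1 else 0) ^ 2 = ((1 : ℕ) : ℝ) := by
        intro i hi
        rw [Finset.mem_symmDiff] at hi
        rcases hi with ⟨h1, h2⟩ | ⟨h1, h2⟩ <;> simp [h1, h2]
      have h2 : ∀ i ∈ Finset.univ.filter (fun i => i ∉ symmDiff A B),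
          ((if i ∈ A then (1 : ℝ) else 0) - if i ∈ B then 1 else 0) ^ 2 = 0 := by
        intro i hi
        rw [Finset.mem_filter, Finset.mem_symmDiff] at hi
        by_cases h1 : i ∈ A <;> by_cases h2 : i ∈ B <;> simp_all
      rw [Finset.sum_congr rfl h1, Finset.sum_eq_zero h2, add_zero]) hV₀ ha
  simp only [signSum, ← Finset.sum_sub_distrib, ← sub_mul]
  exact h

open Classical in
/-- The sign vectors with a large increment along some link of length at most `2 n / 16ʲ` between
two nets. -/
noncomputable def largeLinkSigns {n : ℕ} (S T : Finset (Finset (Fin n))) (t : ℝ) (j : ℕ) :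
    Finset (Fin n → Bool) :=
  Finset.univ.filter fun ε => ∃ A ∈ S, ∃ B ∈ T, ((symmDiff A B).card : ℝ) ≤ 2 * (n / 16 ^ j) ∧
    10 * n * t * (1 / 2) ^ j < |signSum A ε - signSum B ε|

lemma card_largeLinkSigns_le {n : ℕ} (hn : 0 < n) (S T : Finset (Finset (Fin n))) {t : ℝ}
    (ht : 0 ≤ t) (hq : 1 ≤ n * t ^ 2) (j : ℕ)
    (hS : (S.card : ℝ) ≤ Real.exp (6 * (n * t ^ 2) * (j + 1)))
    (hT : (T.card : ℝ) ≤ Real.exp (6 * (n * t ^ 2) * (j + 2))) :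
    ((largeLinkSigns S T t j).card : ℝ) ≤
      2 ^ n * Real.exp (-(n * t ^ 2)) * (1 / 2) ^ (j + 1) := by
  classical
  set q := n * t ^ 2 with hqdef
  have hn' : (0 : ℝ) < n := by exact_mod_cast hn
  have h1 : largeLinkSigns S T t j ⊆
      ((S ×ˢ T).filter fun r => ((symmDiff r.1 r.2).card : ℝ) ≤ 2 * (n / 16 ^ j)).biUnion
        fun r => Finset.univ.filter fun ε =>
          10 * n * t * (1 / 2) ^ j < |signSum r.1 ε - signSum r.2 ε| := by
    intro ε hε
    simp only [largeLinkSigns, Finset.mem_filter, Finset.mem_univ, true_and, Finset.mem_biUnion,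
      Finset.mem_product] at hε ⊢
    obtain ⟨A, hA, B, hB, h1, h2⟩ := hε
    exact ⟨(A, B), ⟨⟨hA, hB⟩, h1⟩, h2⟩
  have h2 := (Finset.card_le_card h1).trans Finset.card_biUnion_le
  have h3 : ∀ r ∈ (S ×ˢ T).filter fun r => ((symmDiff r.1 r.2).card : ℝ) ≤ 2 * (n / 16 ^ j),
      ((Finset.univ.filter fun ε =>
          10 * n * t * (1 / 2) ^ j < |signSum r.1 ε - signSum r.2 ε|).card : ℝ) ≤
        2 ^ n * (2 * Real.exp (-(25 * q * 4 ^ j))) := by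
    intro r hr
    rw [Finset.mem_filter] at hr
    refine (card_lt_abs_signSum_sub_le r.1 r.2 hr.2 (by positivity) (by positivity)).trans_eq ?_
    congr 4
    rw [hqdef, show (16 : ℝ) ^ j = 4 ^ j * 4 ^ j by rw [← mul_pow]; norm_num,
      show (4 : ℝ) ^ j = 2 ^ j * 2 ^ j by rw [← mul_pow]; norm_num, one_div, inv_pow]
    field_simp
    ring
  have h4 : ((((S ×ˢ T).filter fun r => ((symmDiff r.1 r.2).card : ℝ) ≤
      2 * (n / 16 ^ j)).card : ℕ) : ℝ) ≤
      Real.exp (6 * q * (j + 1)) * Real.exp (6 * q * (j + 2)) := by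
    have h5 := Finset.card_filter_le (S ×ˢ T) fun r =>
      ((symmDiff r.1 r.2).card : ℝ) ≤ 2 * (n / 16 ^ j)
    rw [Finset.card_product] at h5
    have h6 := (Nat.cast_le (α := ℝ)).2 h5
    push_cast at h6
    exact h6.trans (mul_le_mul hS hT (by positivity) (Real.exp_pos _).le)
  have hpow : (1 : ℝ) + j * 3 ≤ 4 ^ j := by
    have := one_add_mul_le_pow (by norm_num : (-2 : ℝ) ≤ 3) j
    norm_num at this
    linarith
  have hj : (0 : ℝ) ≤ j := Nat.cast_nonneg j
  have h2e : (2 : ℝ) ≤ Real.exp 1 := by have := Real.exp_one_gt_d9; linarith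
  have h7 : Real.exp (-(j + 1 : ℝ)) ≤ (1 / 2) ^ (j + 1) := by
    rw [show -(j + 1 : ℝ) = ((j + 1 : ℕ) : ℝ) * (-1) by push_cast; ring, Real.exp_nat_mul]
    refine pow_le_pow_left₀ (Real.exp_pos _).le ?_ _
    rw [Real.exp_neg, one_div]
    exact inv_anti₀ (by norm_num) h2e
  calc ((largeLinkSigns S T t j).card : ℝ)
      ≤ _ := (Nat.cast_le (α := ℝ)).2 h2
    _ ≤ (((S ×ˢ T).filter fun r => ((symmDiff r.1 r.2).card : ℝ) ≤ 2 * (n / 16 ^ j)).card : ℝ) *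
        (2 ^ n * (2 * Real.exp (-(25 * q * 4 ^ j)))) := by
      rw [← nsmul_eq_mul, Nat.cast_sum]
      exact Finset.sum_le_card_nsmul _ _ _ h3
    _ ≤ Real.exp (6 * q * (j + 1)) * Real.exp (6 * q * (j + 2)) *
        (2 ^ n * (Real.exp 1 * Real.exp (-(25 * q * 4 ^ j)))) := by gcongr
    _ = 2 ^ n * Real.exp (6 * q * (j + 1) + 6 * q * (j + 2) + (1 - 25 * q * 4 ^ j)) := by
      rw [Real.exp_add, Real.exp_add, sub_eq_add_neg, Real.exp_add]; ring
    _ ≤ 2 ^ n * Real.exp (-q + -(j + 1)) := by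
      refine mul_le_mul_of_nonneg_left (Real.exp_le_exp.2 ?_) (by positivity)
      have h8 : q * (1 + j * 3) ≤ q * 4 ^ j := by gcongr
      have h9 : 0 ≤ (q - 1) * j := mul_nonneg (by linarith) hj
      nlinarith
    _ ≤ _ := by
      rw [Real.exp_add, mul_assoc]
      gcongr

/-- If a sign vector has small increments along all links between nets of scales `16⁻ʲ`, its sums
over all sets are small. -/
lemma abs_signSum_le_of_links {n : ℕ} (N : ℕ → Finset (Finset (Fin n))) (hN : N 0 = {∅})
    {A : Finset (Fin n)} (hA : ∀ j, ∃ B ∈ N j, ((symmDiff A B).card : ℝ) ≤ n / 16 ^ j)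
    {t : ℝ} (ht : 0 ≤ t) (ε : Fin n → Bool)
    (hε : ∀ j < n, ∀ A ∈ N j, ∀ B ∈ N (j + 1), ((symmDiff A B).card : ℝ) ≤ 2 * (n / 16 ^ j) →
      |signSum A ε - signSum B ε| ≤ 10 * n * t * (1 / 2) ^ j) :
    |signSum A ε| ≤ 20 * n * t := by
  choose B hBN hBA using hA
  have hB0 : B 0 = ∅ := by
    have := hBN 0
    rwa [hN, Finset.mem_singleton] at this
  have hBn : B n = A := by
    have h1 := hBA n
    have h2 : (n : ℝ) / 16 ^ n < 1 := by
      rw [div_lt_one (by positivity)]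
      have : n < 16 ^ n := Nat.lt_pow_self (by norm_num)
      exact_mod_cast this
    have h3 : (symmDiff A (B n)).card < 1 := by
      have := h1.trans_lt h2
      exact_mod_cast this
    rw [Nat.lt_one_iff, Finset.card_eq_zero] at h3
    exact (symmDiff_eq_bot.1 h3).symm
  have hind : ∀ j ≤ n, |signSum (B j) ε| ≤
      ∑ i ∈ Finset.range j, 10 * n * t * (1 / 2) ^ i := by
    intro j
    induction j with
    | zero => intro _; simp [hB0, signSum]
    | succ j ih =>
      intro hj
      have h1 : |signSum (B j) ε - signSum (B (j + 1)) ε| ≤ 10 * n * t * (1 / 2) ^ j := by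
        refine hε j hj _ (hBN j) _ (hBN _) ?_
        have h2 : (symmDiff (B j) (B (j + 1))).card ≤
            (symmDiff A (B j)).card + (symmDiff A (B (j + 1))).card := by
          refine (Finset.card_le_card (symmDiff_triangle (B j) A (B (j + 1)))).trans ?_
          rw [symmDiff_comm A (B j)]
          exact Finset.card_union_le _ _
        have h3 := (Nat.cast_le (α := ℝ)).2 h2
        push_cast at h3
        have h4 : (n : ℝ) / 16 ^ (j + 1) ≤ n / 16 ^ j := by
          gcongr
          · norm_num
          · omega
        linarith [hBA j, hBA (j + 1)]
      rw [Finset.sum_range_succ]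
      have h2 := ih (by omega)
      have h3 := abs_sub_abs_le_abs_sub (signSum (B (j + 1)) ε) (signSum (B j) ε)
      rw [abs_sub_comm] at h3
      linarith
  have h1 := hind n le_rfl
  rw [hBn, ← Finset.mul_sum] at h1
  have h2 : ∑ i ∈ Finset.range n, ((1 : ℝ) / 2) ^ i ≤ 2 := sum_geometric_two_le n
  have h3 : 10 * n * t * ∑ i ∈ Finset.range n, ((1 : ℝ) / 2) ^ i ≤ 10 * n * t * 2 := by gcongr
  linarith

/-- Chaining bound for the Rademacher process indexed by a family of polynomial growth. -/
lemma card_exists_lt_abs_signSum_le {E : Type*} {𝒞 : Set (Set E)} {d n : ℕ}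
    (h𝒞 : HasPolynomialGrowth 𝒞 d) (y : Fin n → E) (𝒜 : Finset (Finset (Fin n)))
    (h𝒜 : ∀ S ∈ 𝒜, ∃ A ∈ 𝒞, ∀ i, i ∈ S ↔ y i ∈ A) {t : ℝ} (hn : 0 < n) (ht : 0 ≤ t)
    (hq : 1 ≤ n * t ^ 2) (hd : d ≤ n * t ^ 2) :
    ((Finset.univ.filter fun ε => ∃ A ∈ 𝒜, 20 * n * t < |signSum A ε|).card : ℝ) ≤
      2 ^ n * Real.exp (-(n * t ^ 2)) := by
  obtain ⟨N, hN0, hNcard, hNcov⟩ : ∃ N : ℕ → Finset (Finset (Fin n)), N 0 = {∅} ∧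
      (∀ j, ((N j).card : ℝ) ≤ Real.exp (6 * (n * t ^ 2) * (j + 1))) ∧
      ∀ A ∈ 𝒜, ∀ j, ∃ B ∈ N j, ((symmDiff A B).card : ℝ) ≤ n / 16 ^ j := by
    choose T hTcard hTcov using exists_net_of_growth h𝒞 y 𝒜 h𝒜 hq hd
    refine ⟨fun j => if j = 0 then {∅} else T j, if_pos rfl, fun j => ?_, fun A hA j => ?_⟩
    · by_cases hj : j = 0
      · simp only [hj, if_true, Finset.card_singleton, Nat.cast_one]
        exact Real.one_le_exp (by positivity)
      · simp only [hj, if_false]; exact hTcard j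
    · by_cases hj : j = 0
      · refine ⟨∅, by simp [hj], ?_⟩
        rw [hj, pow_zero, div_one]
        have := Finset.card_le_univ (symmDiff A ∅)
        rw [Fintype.card_fin] at this
        exact_mod_cast this
      · simp only [hj, if_false]; exact hTcov j A hA
  have hsub : (Finset.univ.filter fun ε => ∃ A ∈ 𝒜, 20 * n * t < |signSum A ε|) ⊆
      (Finset.range n).biUnion fun j => largeLinkSigns (N j) (N (j + 1)) t j := by
    intro ε hε
    by_contra hcon
    simp only [largeLinkSigns, Finset.mem_biUnion, Finset.mem_filter, Finset.mem_univ,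
      true_and, Finset.mem_range] at hε hcon
    push Not at hcon
    obtain ⟨A, hA, hlt⟩ := hε
    exact hlt.not_ge (abs_signSum_le_of_links N hN0 (hNcov A hA) ht ε hcon)
  have h1 := (Nat.cast_le (α := ℝ)).2 ((Finset.card_le_card hsub).trans Finset.card_biUnion_le)
  rw [Nat.cast_sum] at h1
  have h3 : ∀ j, ((N (j + 1)).card : ℝ) ≤ Real.exp (6 * (n * t ^ 2) * (j + 2)) := by
    intro j
    have := hNcard (j + 1)
    push_cast at this
    rwa [add_assoc, one_add_one_eq_two] at this
  refine h1.trans ((Finset.sum_le_sum (g := fun j =>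
    2 ^ n * Real.exp (-(n * t ^ 2)) * (1 / 2 : ℝ) ^ (j + 1)) fun j _ => ?_).trans ?_)
  · exact card_largeLinkSigns_le hn (N j) (N (j + 1)) ht hq j (hNcard j) (h3 j)
  rw [← Finset.mul_sum]
  have h2 : ∑ i ∈ Finset.range n, ((1 : ℝ) / 2) ^ (i + 1) ≤ 1 := by
    simp only [pow_succ]
    rw [← Finset.sum_mul]
    linarith [sum_geometric_two_le n]
  exact mul_le_of_le_one_right (by positivity) h2

/-- A weighted sum of functions with values in `[0, 1]` is a mixture of weighted sums over
superlevel sets. -/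
lemma abs_sum_mul_le_of_superlevel {n : ℕ} (f w : Fin n → ℝ) (h₀ : ∀ i, 0 ≤ f i)
    (h₁ : ∀ i, f i ≤ 1) {s : ℝ}
    (hs : ∀ t ∈ Set.Ioo (0 : ℝ) 1, |∑ i, (if t ≤ f i then 1 else 0) * w i| ≤ s) :
    |∑ i, f i * w i| ≤ s := by
  have hint : ∀ i, IntervalIntegrable (fun t => (if t ≤ f i then (1 : ℝ) else 0)) volume 0 1 := by
    intro i
    refine AntitoneOn.intervalIntegrable fun a _ b _ hab => ?_
    have h : ∀ {P Q : Prop} [Decidable P] [Decidable Q], (P → Q) →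
        (if P then (1 : ℝ) else 0) ≤ if Q then 1 else 0 := by
      intro P Q _ _ h
      split_ifs with h₁ h₂ h₃
      exacts [le_rfl, absurd (h h₁) h₂, zero_le_one, le_rfl]
    exact h hab.trans
  have hval : ∀ i, ∫ t in (0 : ℝ)..1, (if t ≤ f i then (1 : ℝ) else 0) = f i := by
    intro i
    have : (fun t => (if t ≤ f i then (1 : ℝ) else 0)) = (Set.Iic (f i)).indicator fun _ => 1 := by
      ext t
      simp [Set.indicator_apply]
    rw [this, intervalIntegral.integral_of_le zero_le_one,
      setIntegral_indicator measurableSet_Iic, Set.Ioc_inter_Iic, min_eq_right (h₁ i)]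
    simp [h₀ i]
  have hsum : ∑ i, f i * w i =
      ∫ t in (0 : ℝ)..1, ∑ i, (if t ≤ f i then (1 : ℝ) else 0) * w i := by
    rw [intervalIntegral.integral_finsetSum fun i _ => (hint i).mul_const _]
    refine Finset.sum_congr rfl fun i _ => ?_
    rw [intervalIntegral.integral_mul_const, hval]
  rw [hsum, ← Real.norm_eq_abs, intervalIntegral.integral_of_le zero_le_one,
    integral_Ioc_eq_integral_Ioo]
  refine (norm_setIntegral_le_of_norm_le_const (C := s) (by simp) fun t ht => ?_).trans_eq ?_
  · exact hs t ht
  · simp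

/-- Chaining bound for the Rademacher process indexed by functions whose superlevel sets have
polynomial growth. -/
lemma card_exists_lt_abs_sum_boolSign_le {E ι : Type*} {𝒞 : Set (Set E)} {d n : ℕ}
    (h𝒞 : HasPolynomialGrowth 𝒞 d) (y : Fin n → E) (f : ι → E → ℝ) (h₀ : ∀ k x, 0 ≤ f k x)
    (h₁ : ∀ k x, f k x ≤ 1) (hf : ∀ k, ∀ t ∈ Set.Ioo (0 : ℝ) 1, {x | t ≤ f k x} ∈ 𝒞)
    {t : ℝ} (hn : 0 < n) (ht : 0 ≤ t) (hq : 1 ≤ n * t ^ 2) (hd : d ≤ n * t ^ 2) :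
    (Set.ncard {ε : Fin n → Bool | ∃ k, 20 * n * t < |∑ i, f k (y i) * boolSign (ε i)|} : ℝ) ≤
      2 ^ n * Real.exp (-(n * t ^ 2)) := by
  classical
  set 𝒜 : Finset (Finset (Fin n)) :=
    Finset.univ.filter fun S => ∃ A ∈ 𝒞, ∀ i, i ∈ S ↔ y i ∈ A with h𝒜
  refine le_trans ?_ (card_exists_lt_abs_signSum_le h𝒞 y 𝒜 (fun S hS => by simpa [h𝒜] using hS)
    hn ht hq hd)
  rw [← Set.ncard_coe_finset]
  refine Nat.cast_le.2 (Set.ncard_le_ncard ?_ (Finset.finite_toSet _))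
  rintro ε ⟨k, hk⟩
  simp only [Finset.coe_filter, Finset.mem_univ, true_and, Set.mem_ofPred_eq]
  by_contra! hcon
  refine hk.not_ge (abs_sum_mul_le_of_superlevel _ _ (fun i => h₀ k _) (fun i => h₁ k _)
    fun s hs => ?_)
  have h1 := hcon (Finset.univ.filter fun i => s ≤ f k (y i)) (by
    simp only [h𝒜, Finset.mem_filter, Finset.mem_univ, true_and]
    exact ⟨_, hf k s hs, fun i => Iff.rfl⟩)
  simpa [signSum] using h1

/-- The closed half-spaces, together with the empty set and the whole space. -/
def closedHalfSpaces (E : Type*) [NormedAddCommGroup E] [InnerProductSpace ℝ E] : Set (Set E) :=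
  {H | ∃ (u : E) (b : ℝ), H = {x | b ≤ inner ℝ u x}}

lemma card_le_of_shatters_closedHalfSpaces {E : Type*} [NormedAddCommGroup E]
    [InnerProductSpace ℝ E] [FiniteDimensional ℝ E] {m : ℕ} (y : Fin m → E)
    (T : Finset (Finset (Fin m)))
    (hT : ∀ S ∈ T, ∃ A ∈ closedHalfSpaces E, ∀ i, i ∈ S ↔ y i ∈ A) {S : Finset (Fin m)}
    (hS : T.Shatters S) : S.card ≤ Module.finrank ℝ E + 1 := by
  by_contra! hcard
  have hdep : ¬ LinearIndependent ℝ fun i : S => ((y i, 1) : E × ℝ) := by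
    intro h
    have := h.fintype_card_le_finrank
    rw [Module.finrank_prod, Module.finrank_self, Fintype.card_coe] at this
    omega
  rw [Fintype.not_linearIndependent_iff] at hdep
  obtain ⟨g, hg, i₀, hi₀⟩ := hdep
  have h1 := congrArg Prod.fst hg
  have h2 := congrArg Prod.snd hg
  simp only [Prod.smul_mk, smul_eq_mul, mul_one, Prod.fst_sum, Prod.snd_sum, Prod.fst_zero,
    Prod.snd_zero] at h1 h2
  obtain ⟨i₁, hi₁⟩ : ∃ i, g i < 0 := by
    by_contra! hnn
    exact hi₀ ((Finset.sum_eq_zero_iff_of_nonneg fun i _ => hnn i).1 h2 i₀ (Finset.mem_univ _))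
  obtain ⟨R, hR, hRS⟩ := hS (t := (Finset.univ.filter fun i : S => 0 ≤ g i).map
    (Function.Embedding.subtype _)) (by
      intro i hi
      simp only [Finset.mem_map, Function.Embedding.subtype_apply] at hi
      obtain ⟨j, _, rfl⟩ := hi
      exact j.2)
  obtain ⟨H, ⟨u, b, rfl⟩, hH⟩ := hT R hR
  have h3 : ∀ i : S, 0 ≤ g i ↔ b ≤ inner ℝ u (y i) := by
    intro i
    have h4 := congrArg (fun U => (i : Fin m) ∈ U) hRS
    rw [eq_iff_iff, Finset.mem_inter, hH] at h4
    simpa using h4.symm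
  have h4 : ∑ i, g i * (inner ℝ u (y i) - b) = 0 := by
    have h5 : inner ℝ u (∑ i, g i • y i) = 0 := by rw [h1, inner_zero_right]
    rw [inner_sum] at h5
    simp only [inner_smul_right] at h5
    simp only [mul_sub, Finset.sum_sub_distrib, h5, ← Finset.sum_mul, h2, zero_mul, sub_zero]
  refine h4.not_gt (Finset.sum_pos' (fun i _ => ?_) ⟨i₁, Finset.mem_univ _, ?_⟩)
  · rcases le_or_gt 0 (g i) with h | h
    · exact mul_nonneg h (sub_nonneg.2 ((h3 i).1 h))
    · have h5 := mt (h3 i).2 h.not_ge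
      exact mul_nonneg_of_nonpos_of_nonpos h.le (by linarith)
  · have h5 := mt (h3 i₁).2 hi₁.not_ge
    exact mul_pos_of_neg_of_neg hi₁ (by linarith)

lemma hasPolynomialGrowth_closedHalfSpaces (E : Type*) [NormedAddCommGroup E]
    [InnerProductSpace ℝ E] [FiniteDimensional ℝ E] :
    HasPolynomialGrowth (closedHalfSpaces E) (Module.finrank ℝ E + 1) := by
  intro m y T hT
  refine T.card_le_card_shatterer.trans (Finset.card_shatterer_le_sum_vcDim.trans ?_)
  rw [Fintype.card_fin]
  refine Finset.sum_le_sum_of_subset fun k hk => ?_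
  rw [Finset.mem_Iic] at hk
  rw [Finset.mem_range]
  have h1 : T.vcDim ≤ Module.finrank ℝ E + 1 := Finset.sup_le fun S hS =>
    card_le_of_shatters_closedHalfSpaces y T hT (Finset.mem_shatterer.1 hS)
  omega

lemma boolSign_mul_sub {E : Type*} (g : E → ℝ) (b : Bool) (z : E × E) :
    g (if b then z else z.swap).1 - g (if b then z else z.swap).2 =
      (g z.1 - g z.2) * boolSign b := by
  cases b <;> simp [boolSign]

section Empirical

variable {E : Type*} [MeasurableSpace E] {n d : ℕ} {t : ℝ}

lemma measurePreserving_signedSwap (P : Measure E) [IsProbabilityMeasure P] (ε : Fin n → Bool) :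
    MeasurePreserving (fun (z : Fin n → E × E) i => if ε i then z i else (z i).swap)
      (Measure.pi fun _ => P.prod P) (Measure.pi fun _ => P.prod P) := by
  refine measurePreserving_pi (f := fun i (w : E × E) => if ε i then w else w.swap) _ _ fun i => ?_
  cases ε i
  · simpa using! Measure.measurePreserving_swap
  · simpa using! MeasurePreserving.id _

/-- A measurable event has small probability if, for each pair sample, it has small probability
under random swaps. -/
lemma measure_le_of_forall_signedSwap (P : Measure E) [IsProbabilityMeasure P]
    {B : Set (Fin n → E × E)} (hB : MeasurableSet B) {δ : ℝ}
    (h : ∀ z : Fin n → E × E, (Set.ncard {ε : Fin n → Bool |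
      (fun i => if ε i then z i else (z i).swap) ∈ B} : ℝ) ≤ 2 ^ n * δ) :
    Measure.pi (fun _ => P.prod P) B ≤ ENNReal.ofReal δ := by
  classical
  set W : Measure (Fin n → E × E) := Measure.pi fun _ => P.prod P with hW
  have h1 : ∀ ε : Fin n → Bool, W B =
      ∫⁻ z, B.indicator 1 (fun i => if ε i then z i else (z i).swap) ∂W := by
    intro ε
    rw [(measurePreserving_signedSwap P ε).lintegral_comp
      (measurable_one.indicator hB : Measurable (B.indicator (1 : (Fin n → E × E) → ENNReal))),
      lintegral_indicator_one hB]
  have h2 : ∑ _ε : Fin n → Bool, W B =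
      ∫⁻ z, ∑ ε : Fin n → Bool,
        B.indicator 1 (fun i => if ε i then z i else (z i).swap) ∂W := by
    rw [lintegral_finsetSum]
    · exact Finset.sum_congr rfl fun ε _ => h1 ε
    · intro ε _
      exact (measurable_one.indicator hB).comp (measurePreserving_signedSwap P ε).measurable
  have h3 : ∀ z : Fin n → E × E, ∑ ε : Fin n → Bool,
      B.indicator (1 : (Fin n → E × E) → ENNReal) (fun i => if ε i then z i else (z i).swap) ≤
      ENNReal.ofReal (2 ^ n * δ) := by
    intro z
    have h4 : ∑ ε : Fin n → Bool,
        B.indicator (1 : (Fin n → E × E) → ENNReal) (fun i => if ε i then z i else (z i).swap) =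
        ((Finset.univ.filter fun ε : Fin n → Bool =>
          (fun i => if ε i then z i else (z i).swap) ∈ B).card : ENNReal) := by
      simp only [Set.indicator_apply, Pi.one_apply]
      rw [Finset.sum_boole]
    rw [h4, ← ENNReal.ofReal_natCast]
    refine ENNReal.ofReal_le_ofReal (le_trans (le_of_eq ?_) (h z))
    rw [← Set.ncard_coe_finset]
    simp
  have h5 : (2 ^ n : ENNReal) * W B ≤ 2 ^ n * ENNReal.ofReal δ := by
    calc (2 ^ n : ENNReal) * W B = ∑ _ε : Fin n → Bool, W B := by simp
      _ ≤ ∫⁻ _, ENNReal.ofReal (2 ^ n * δ) ∂W := by rw [h2]; exact lintegral_mono h3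
      _ = 2 ^ n * ENNReal.ofReal δ := by
        rw [lintegral_const, measure_univ, mul_one, ENNReal.ofReal_mul (by positivity),
          ENNReal.ofReal_pow (by norm_num)]
        simp
  exact (ENNReal.mul_le_mul_iff_right (by simp) (by simp)).1 h5

lemma measure_pair_deviation_le {𝒞 : Set (Set E)} (h𝒞 : HasPolynomialGrowth 𝒞 d) (P : Measure E)
    [IsProbabilityMeasure P] (f : ℕ → E → ℝ) (hm : ∀ k, Measurable (f k)) (h₀ : ∀ k x, 0 ≤ f k x)
    (h₁ : ∀ k x, f k x ≤ 1) (hf : ∀ k, ∀ t ∈ Set.Ioo (0 : ℝ) 1, {x | t ≤ f k x} ∈ 𝒞)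
    (hn : 0 < n) (ht : 0 ≤ t) (hq : 1 ≤ n * t ^ 2) (hd : d ≤ n * t ^ 2) :
    Measure.pi (fun _ => P.prod P)
      {z : Fin n → E × E | ∃ k, 40 * n * t < |∑ i, (f k (z i).1 - f k (z i).2)|} ≤
      ENNReal.ofReal (2 * Real.exp (-(n * t ^ 2))) := by
  have hmeas : MeasurableSet
      {z : Fin n → E × E | ∃ k, 40 * n * t < |∑ i, (f k (z i).1 - f k (z i).2)|} := by
    rw [Set.ofPred_exists]
    refine MeasurableSet.iUnion fun k => measurableSet_lt measurable_const ?_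
    have := hm k
    fun_prop
  refine measure_le_of_forall_signedSwap P hmeas fun z => ?_
  have h1 := card_exists_lt_abs_sum_boolSign_le h𝒞 (fun i => (z i).1) f h₀ h₁ hf hn ht hq hd
  have h2 := card_exists_lt_abs_sum_boolSign_le h𝒞 (fun i => (z i).2) f h₀ h₁ hf hn ht hq hd
  have h3 : {ε : Fin n → Bool | (fun i => if ε i then z i else (z i).swap) ∈
      {z : Fin n → E × E | ∃ k, 40 * n * t < |∑ i, (f k (z i).1 - f k (z i).2)|}} ⊆
      {ε | ∃ k, 20 * n * t < |∑ i, f k (z i).1 * boolSign (ε i)|} ∪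
      {ε | ∃ k, 20 * n * t < |∑ i, f k (z i).2 * boolSign (ε i)|} := by
    rintro ε ⟨k, hk⟩
    simp only [boolSign_mul_sub, sub_mul, Finset.sum_sub_distrib] at hk
    by_contra hcon
    simp only [Set.mem_union, Set.mem_ofPred_eq, not_or, not_exists, not_lt] at hcon
    have := abs_sub (∑ i, f k (z i).1 * boolSign (ε i)) (∑ i, f k (z i).2 * boolSign (ε i))
    linarith [hcon.1 k, hcon.2 k]
  have h4 := (Set.ncard_le_ncard h3 (Set.toFinite _)).trans (Set.ncard_union_le _ _)
  have h5 := (Nat.cast_le (α := ℝ)).2 h4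
  push_cast at h5
  linarith

lemma half_le_measure_abs_sum_sub_le (P : Measure E) [IsProbabilityMeasure P] {g : E → ℝ}
    (hm : Measurable g) (h₀ : ∀ x, 0 ≤ g x) (h₁ : ∀ x, g x ≤ 1)
    (hn : 0 < n) (ht : 0 < t) (hq : 1 ≤ n * t ^ 2) :
    1 / 2 ≤ Measure.pi (fun _ => P)
      {x : Fin n → E | |∑ i, g (x i) - n * ∫ y, g y ∂P| ≤ 40 * n * t} := by
  have hn' : (0 : ℝ) < n := by exact_mod_cast hn
  have hL : MemLp g 2 P := MemLp.of_bound hm.aestronglyMeasurable 1 (Filter.Eventually.of_forall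
    fun x => by rw [Real.norm_eq_abs, abs_of_nonneg (h₀ x)]; exact h₁ x)
  have hLi : ∀ i : Fin n, MemLp (fun x : Fin n → E => g (x i)) 2 (Measure.pi fun _ => P) :=
    fun i => hL.comp_measurePreserving (measurePreserving_eval (fun _ => P) i)
  have hsum : (∑ i : Fin n, fun x : Fin n → E => g (x i)) = fun x => ∑ i, g (x i) := by
    ext x; simp
  have hvar : ProbabilityTheory.variance (fun x : Fin n → E => ∑ i, g (x i))
      (Measure.pi fun _ => P) ≤ n := by
    rw [← hsum, ProbabilityTheory.variance_sum_pi fun _ => hL]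
    have h2 : ProbabilityTheory.variance g P ≤ ((1 - 0) / 2) ^ 2 :=
      ProbabilityTheory.variance_le_sq_of_bounded (Filter.Eventually.of_forall
        fun x => ⟨h₀ x, h₁ x⟩) hm.aemeasurable
    simp only [Finset.sum_const, Finset.card_univ, Fintype.card_fin, nsmul_eq_mul]
    nlinarith
  have hint : ∫ x : Fin n → E, ∑ i, g (x i) ∂(Measure.pi fun _ => P) = n * ∫ y, g y ∂P := by
    rw [integral_finsetSum _ fun i _ => (hLi i).integrable (by norm_num)]
    have : ∀ i : Fin n, ∫ x : Fin n → E, g (x i) ∂(Measure.pi fun _ => P) = ∫ y, g y ∂P :=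
      fun i => integral_comp_eval (μ := fun _ => P) hm.aestronglyMeasurable
    simp [this]
  have hL2 : MemLp (fun x : Fin n → E => ∑ i, g (x i)) 2 (Measure.pi fun _ => P) :=
    memLp_finsetSum _ fun i _ => hLi i
  have hcheb := ProbabilityTheory.meas_ge_le_variance_div_sq hL2
    (by positivity : 0 < 40 * n * t)
  rw [hint] at hcheb
  have hms : MeasurableSet {x : Fin n → E | |∑ i, g (x i) - n * ∫ y, g y ∂P| ≤ 40 * n * t} :=
    measurableSet_le (by fun_prop) measurable_const
  have h3 : Measure.pi (fun _ => P)
      {x : Fin n → E | |∑ i, g (x i) - n * ∫ y, g y ∂P| ≤ 40 * n * t}ᶜ ≤ 1 / 2 := by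
    refine (measure_mono fun x hx => ?_).trans (hcheb.trans ?_)
    · simp only [Set.mem_compl_iff, Set.mem_ofPred_eq, not_le] at hx ⊢
      exact hx.le
    · rw [← ENNReal.ofReal_one, show (2 : ENNReal) = ENNReal.ofReal 2 by simp,
        ← ENNReal.ofReal_div_of_pos (by norm_num)]
      refine ENNReal.ofReal_le_ofReal ?_
      rw [div_le_div_iff₀ (by positivity) (by norm_num)]
      nlinarith
  have h4 := prob_add_prob_compl (μ := Measure.pi fun _ : Fin n => P) hms
  by_contra! hcon
  have h5 := ENNReal.add_lt_add_of_lt_of_le (by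
    exact ne_top_of_le_ne_top (by simp) h3) hcon h3
  rw [h4, ENNReal.add_halves] at h5
  exact lt_irrefl _ h5

/-- Uniform deviation of empirical means over a countable class of functions with values in
`[0, 1]` whose superlevel sets have polynomial growth. -/
lemma measure_deviation_le {𝒞 : Set (Set E)} (h𝒞 : HasPolynomialGrowth 𝒞 d) (P : Measure E)
    [IsProbabilityMeasure P] (f : ℕ → E → ℝ) (hm : ∀ k, Measurable (f k)) (h₀ : ∀ k x, 0 ≤ f k x)
    (h₁ : ∀ k x, f k x ≤ 1) (hf : ∀ k, ∀ t ∈ Set.Ioo (0 : ℝ) 1, {x | t ≤ f k x} ∈ 𝒞)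
    (hn : 0 < n) (ht : 0 < t) (hq : 1 ≤ n * t ^ 2) (hd : d ≤ n * t ^ 2) :
    Measure.pi (fun _ => P)
      {x : Fin n → E | ∃ k, 80 * n * t < |∑ i, f k (x i) - n * ∫ y, f k y ∂P|} ≤
      ENNReal.ofReal (4 * Real.exp (-(n * t ^ 2))) := by
  set μ : Measure (Fin n → E) := Measure.pi fun _ => P with hμ
  set B := {x : Fin n → E | ∃ k, 80 * n * t < |∑ i, f k (x i) - n * ∫ y, f k y ∂P|} with hBdef
  set G := {w : (Fin n → E) × (Fin n → E) |
    ∃ k, 40 * n * t < |∑ i, (f k (w.1 i) - f k (w.2 i))|} with hG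
  have hB : MeasurableSet B := by
    rw [hBdef, Set.ofPred_exists]
    refine MeasurableSet.iUnion fun k => measurableSet_lt measurable_const ?_
    have := hm k
    fun_prop
  have hGm : MeasurableSet G := by
    rw [hG, Set.ofPred_exists]
    refine MeasurableSet.iUnion fun k => measurableSet_lt measurable_const ?_
    have := hm k
    fun_prop
  have h2 : (μ.prod μ) G ≤ ENNReal.ofReal (2 * Real.exp (-(n * t ^ 2))) := by
    rw [← (measurePreserving_arrowProdEquivProdArrow E E (Fin n) (fun _ => P)
      (fun _ => P)).measure_preimage hGm.nullMeasurableSet]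
    exact measure_pair_deviation_le h𝒞 P f hm h₀ h₁ hf hn ht.le hq hd
  have h3 : 1 / 2 * μ B ≤ (μ.prod μ) G := by
    rw [Measure.prod_apply hGm, ← lintegral_indicator_const hB]
    refine lintegral_mono fun x => ?_
    by_cases hx : x ∈ B
    · rw [Set.indicator_of_mem hx]
      obtain ⟨k, hk⟩ := hx
      refine (half_le_measure_abs_sum_sub_le P (hm k) (h₀ k) (h₁ k) hn ht hq).trans
        (measure_mono fun x' hx' => ⟨k, ?_⟩)
      simp only [Set.mem_ofPred_eq] at hx'
      rw [Finset.sum_sub_distrib]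
      have h4 := abs_sub_abs_le_abs_sub (∑ i, f k (x i) - n * ∫ y, f k y ∂P)
        (∑ i, f k (x' i) - n * ∫ y, f k y ∂P)
      rw [sub_sub_sub_cancel_right] at h4
      linarith
    · rw [Set.indicator_of_notMem hx]
      exact zero_le
  calc μ B = 2 * (1 / 2 * μ B) := by
        rw [← mul_assoc, ENNReal.mul_div_cancel (by simp) (by simp), one_mul]
    _ ≤ 2 * ENNReal.ofReal (2 * Real.exp (-(n * t ^ 2))) := by
        gcongr
        exact h3.trans h2
    _ = _ := by
        rw [show (2 : ENNReal) = ENNReal.ofReal 2 by simp, ← ENNReal.ofReal_mul (by norm_num)]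
        congr 1
        ring

end Empirical

namespace Activation

lemma fn_nonneg (σ : Activation) (x : ℝ) : 0 ≤ σ.fn x := by
  cases σ
  · exact Set.indicator_nonneg (fun _ _ => zero_le_one) x
  · exact Real.sigmoid_nonneg x
  · exact le_max_right _ _

lemma fn_le_one (σ : Activation) (x : ℝ) : σ.fn x ≤ 1 := by
  cases σ
  · exact Set.indicator_le_self' (fun _ _ => zero_le_one) x
  · exact Real.sigmoid_le_one x
  · exact max_le (min_le_right _ _) zero_le_one

lemma monotone_fn (σ : Activation) : Monotone σ.fn := by
  intro x y hxy
  cases σ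
  · simp only [fn, Set.indicator_apply, Set.mem_Ici, Pi.one_apply]
    split_ifs with h₁ h₂ h₃
    exacts [le_rfl, absurd (h₁.trans hxy) h₂, zero_le_one, le_rfl]
  · exact Real.sigmoid_monotone hxy
  · exact max_le_max (min_le_min (by linarith) le_rfl) le_rfl

lemma measurable_fn (σ : Activation) : Measurable σ.fn := σ.monotone_fn.measurable

lemma continuous_fn_ramp : Continuous Activation.ramp.fn := by
  change Continuous fun x : ℝ => max (min (x + 1 / 2) 1) 0
  fun_prop

lemma exists_forall_le_fn_iff (σ : Activation) {t : ℝ} (ht : t ∈ Set.Ioo (0 : ℝ) 1) :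
    ∃ s, ∀ x, t ≤ σ.fn x ↔ s ≤ x := by
  obtain ⟨h₀, h₁⟩ := ht
  cases σ
  · refine ⟨1, fun x => ?_⟩
    simp only [fn, Set.indicator_apply, Set.mem_Ici, Pi.one_apply]
    split_ifs with h
    · simp [h, h₁.le]
    · simp [h, h₀]
  · have : t ∈ Set.range Real.sigmoid := by rw [Real.range_sigmoid]; exact ⟨h₀, h₁⟩
    obtain ⟨s, rfl⟩ := this
    exact ⟨s, fun x => Real.sigmoid_le_iff⟩
  · refine ⟨t - 1 / 2, fun x => ?_⟩
    simp only [fn, le_max_iff, le_min_iff]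
    constructor
    · rintro (h | h) <;> linarith
    · intro h
      exact Or.inl ⟨by linarith, h₁.le⟩

lemma fn_neg_two_lt_fn_two (σ : Activation) : σ.fn (-2) < σ.fn 2 := by
  cases σ
  · simp only [fn, Set.indicator_apply, Set.mem_Ici, Pi.one_apply]
    norm_num
  · exact Real.sigmoid_lt (by norm_num)
  · simp only [fn]
    norm_num

/-- The indicator activation is a pointwise limit of rescaled ramps. -/
lemma tendsto_ramp_fn (x : ℝ) :
    Filter.Tendsto (fun m : ℕ => Activation.ramp.fn (m * (x - 1) + 1 / 2)) Filter.atTop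
      (nhds (Activation.indicator.fn x)) := by
  refine tendsto_const_nhds.congr' ?_
  simp only [fn, Set.indicator_apply, Set.mem_Ici, Pi.one_apply]
  split_ifs with h
  · refine Filter.Eventually.of_forall fun m => ?_
    have : (0 : ℝ) ≤ m * (x - 1) := mul_nonneg (Nat.cast_nonneg m) (by linarith)
    beta_reduce
    rw [min_eq_right (by linarith), max_eq_left zero_le_one]
  · obtain ⟨N, hN⟩ := exists_nat_ge (1 / (1 - x))
    refine Filter.eventually_atTop.2 ⟨N, fun m hm => ?_⟩
    have h1 : 1 / (1 - x) ≤ m := hN.trans (by exact_mod_cast hm)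
    rw [div_le_iff₀ (by linarith)] at h1
    beta_reduce
    rw [eq_comm, max_eq_right]
    exact min_le_of_left_le (by linarith)

end Activation

section Deviation

variable {n p : ℕ} {t : ℝ}

lemma exists_uniform_deviation_of_continuous (σ : Activation) (hσ : Continuous σ.fn)
    (P : Measure (EuclideanSpace ℝ (Fin p))) [IsProbabilityMeasure P] (hn : 0 < n) (hp : 0 < p)
    (ht : 0 < t) (hpt : p ≤ n * t ^ 2) :
    ∃ E : Set (Fin n → EuclideanSpace ℝ (Fin p)), MeasurableSet E ∧
      1 - Real.exp (-(n * t ^ 2)) ≤ (Measure.pi fun _ : Fin n => P).real E ∧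
      ∀ x ∈ E, ∀ (u : EuclideanSpace ℝ (Fin p)) (b : ℝ),
        |1 / (n : ℝ) * ∑ i, σ.fn (inner ℝ u (x i) + b) - ∫ y, σ.fn (inner ℝ u y + b) ∂P| ≤
          160 * t := by
  have hn' : (0 : ℝ) < n := by exact_mod_cast hn
  have hp' : (1 : ℝ) ≤ p := by exact_mod_cast hp
  set e := TopologicalSpace.denseSeq (EuclideanSpace ℝ (Fin p) × ℝ) with he
  set f : ℕ → EuclideanSpace ℝ (Fin p) → ℝ := fun k x => σ.fn (inner ℝ (e k).1 x + (e k).2) with hf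
  have hm : ∀ k, Measurable (f k) := fun k => by
    have := σ.measurable_fn
    fun_prop
  have hdev := measure_deviation_le (n := n) (t := 2 * t)
    (hasPolynomialGrowth_closedHalfSpaces (EuclideanSpace ℝ (Fin p))) P f hm
    (fun k x => σ.fn_nonneg _) (fun k x => σ.fn_le_one _) (by
      intro k s hs
      obtain ⟨r, hr⟩ := σ.exists_forall_le_fn_iff hs
      refine ⟨(e k).1, r - (e k).2, ?_⟩
      ext x
      simp only [hf, Set.mem_ofPred_eq, hr, sub_le_iff_le_add]) hn (by positivity) (by nlinarith)
    (by
      rw [finrank_euclideanSpace, Fintype.card_fin]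
      push_cast
      nlinarith)
  refine ⟨{x | ∃ k, 80 * n * (2 * t) < |∑ i, f k (x i) - n * ∫ y, f k y ∂P|}ᶜ, ?_, ?_, ?_⟩
  · refine MeasurableSet.compl ?_
    rw [Set.ofPred_exists]
    refine MeasurableSet.iUnion fun k => measurableSet_lt measurable_const ?_
    have := hm k
    fun_prop
  · have hms : MeasurableSet {x : Fin n → EuclideanSpace ℝ (Fin p) |
        ∃ k, 80 * n * (2 * t) < |∑ i, f k (x i) - n * ∫ y, f k y ∂P|} := by
      rw [Set.ofPred_exists]
      refine MeasurableSet.iUnion fun k => measurableSet_lt measurable_const ?_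
      have := hm k
      fun_prop
    rw [probReal_compl_eq_one_sub hms]
    have h1 : (Measure.pi fun _ : Fin n => P).real {x : Fin n → EuclideanSpace ℝ (Fin p) |
        ∃ k, 80 * n * (2 * t) < |∑ i, f k (x i) - n * ∫ y, f k y ∂P|} ≤
        4 * Real.exp (-(n * (2 * t) ^ 2)) :=
      ENNReal.toReal_le_of_le_ofReal (by positivity) hdev
    have h2 : 4 * Real.exp (-(n * (2 * t) ^ 2)) ≤ Real.exp (-(n * t ^ 2)) := by
      have h3 : (4 : ℝ) ≤ Real.exp 3 := by
        have := Real.add_one_le_exp (3 : ℝ)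
        linarith
      calc 4 * Real.exp (-(n * (2 * t) ^ 2)) ≤ Real.exp 3 * Real.exp (-(n * (2 * t) ^ 2)) := by
            gcongr
        _ = Real.exp (3 + -(n * (2 * t) ^ 2)) := (Real.exp_add _ _).symm
        _ ≤ _ := Real.exp_le_exp.2 (by nlinarith)
    linarith
  · intro x hx
    have hcont : Continuous fun q : EuclideanSpace ℝ (Fin p) × ℝ =>
        |1 / (n : ℝ) * ∑ i, σ.fn (inner ℝ q.1 (x i) + q.2) -
          ∫ y, σ.fn (inner ℝ q.1 y + q.2) ∂P| := by
      refine ((continuous_const.mul (by fun_prop)).sub ?_).abs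
      refine continuous_of_dominated (bound := fun _ => 1) (fun q => ?_)
        (fun q => Filter.Eventually.of_forall fun y => ?_) (integrable_const _)
        (Filter.Eventually.of_forall fun y => by fun_prop)
      · have := σ.measurable_fn
        exact Measurable.aestronglyMeasurable (by fun_prop)
      · rw [Real.norm_eq_abs, abs_of_nonneg (σ.fn_nonneg _)]
        exact σ.fn_le_one _
    have hclosed : IsClosed {q : EuclideanSpace ℝ (Fin p) × ℝ |
        |1 / (n : ℝ) * ∑ i, σ.fn (inner ℝ q.1 (x i) + q.2) -
          ∫ y, σ.fn (inner ℝ q.1 y + q.2) ∂P| ≤ 160 * t} :=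
      isClosed_le hcont continuous_const
    have hk : ∀ k, |1 / (n : ℝ) * ∑ i, f k (x i) - ∫ y, f k y ∂P| ≤ 160 * t := by
      intro k
      simp only [Set.mem_compl_iff, Set.mem_ofPred_eq, not_exists, not_lt] at hx
      have h1 := hx k
      refine le_of_mul_le_mul_left ?_ hn'
      calc (n : ℝ) * |1 / (n : ℝ) * ∑ i, f k (x i) - ∫ y, f k y ∂P|
          = |∑ i, f k (x i) - n * ∫ y, f k y ∂P| := by
            rw [← abs_of_pos hn', ← abs_mul, abs_of_pos hn', mul_sub, ← mul_assoc,
              mul_one_div_cancel hn'.ne', one_mul]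
        _ ≤ n * (160 * t) := by linarith
    intro u b
    exact (TopologicalSpace.denseRange_denseSeq (EuclideanSpace ℝ (Fin p) × ℝ)).induction_on
      (p := fun q => |1 / (n : ℝ) * ∑ i, σ.fn (inner ℝ q.1 (x i) + q.2) -
        ∫ y, σ.fn (inner ℝ q.1 y + q.2) ∂P| ≤ 160 * t) (u, b) hclosed hk

/-- With high probability, the empirical means of all ridge functions `x ↦ σ(uᵀx + b)` are close
to their expectations. -/
lemma exists_uniform_deviation (σ : Activation)
    (P : Measure (EuclideanSpace ℝ (Fin p))) [IsProbabilityMeasure P] (hn : 0 < n) (hp : 0 < p)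
    (ht : 0 < t) (hpt : p ≤ n * t ^ 2) :
    ∃ E : Set (Fin n → EuclideanSpace ℝ (Fin p)), MeasurableSet E ∧
      1 - Real.exp (-(n * t ^ 2)) ≤ (Measure.pi fun _ : Fin n => P).real E ∧
      ∀ x ∈ E, ∀ (u : EuclideanSpace ℝ (Fin p)) (b : ℝ),
        |1 / (n : ℝ) * ∑ i, σ.fn (inner ℝ u (x i) + b) - ∫ y, σ.fn (inner ℝ u y + b) ∂P| ≤
          160 * t := by
  cases σ with
  | sigmoid =>
    exact exists_uniform_deviation_of_continuous .sigmoid continuous_sigmoid P hn hp ht hpt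
  | ramp =>
    exact exists_uniform_deviation_of_continuous .ramp Activation.continuous_fn_ramp P hn hp ht hpt
  | indicator =>
    obtain ⟨E, hE, hPE, h⟩ := exists_uniform_deviation_of_continuous .ramp
      Activation.continuous_fn_ramp P hn hp ht hpt
    refine ⟨E, hE, hPE, fun x hx u b => ?_⟩
    have harg : ∀ (m : ℕ) (y : EuclideanSpace ℝ (Fin p)),
        inner ℝ ((m : ℝ) • u) y + (m * (b - 1) + 1 / 2) =
          m * (inner ℝ u y + b - 1) + 1 / 2 := by
      intro m y
      rw [real_inner_smul_left]
      ring
    have h1 : Filter.Tendsto (fun m : ℕ => ∫ y, Activation.ramp.fn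
        (inner ℝ ((m : ℝ) • u) y + (m * (b - 1) + 1 / 2)) ∂P) Filter.atTop
        (nhds (∫ y, Activation.indicator.fn (inner ℝ u y + b) ∂P)) := by
      refine tendsto_integral_of_dominated_convergence (fun _ => 1) (fun m => ?_)
        (integrable_const _) (fun m => Filter.Eventually.of_forall fun y => ?_)
        (Filter.Eventually.of_forall fun y => ?_)
      · have := Activation.ramp.measurable_fn
        exact Measurable.aestronglyMeasurable (by fun_prop)
      · rw [Real.norm_eq_abs, abs_of_nonneg (Activation.fn_nonneg _ _)]
        exact Activation.fn_le_one _ _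
      · simp only [harg]
        exact Activation.tendsto_ramp_fn _
    have h2 : Filter.Tendsto (fun m : ℕ => 1 / (n : ℝ) * ∑ i, Activation.ramp.fn
        (inner ℝ ((m : ℝ) • u) (x i) + (m * (b - 1) + 1 / 2))) Filter.atTop
        (nhds (1 / (n : ℝ) * ∑ i, Activation.indicator.fn (inner ℝ u (x i) + b))) := by
      refine tendsto_const_nhds.mul (tendsto_finsetSum _ fun i _ => ?_)
      simp only [harg]
      exact Activation.tendsto_ramp_fn _
    exact le_of_tendsto (h2.sub h1).abs
      (Filter.Eventually.of_forall fun m => h x hx ((m : ℝ) • u) _)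

end Deviation

/-- The law with density `h`. -/
noncomputable def densityLaw (h : ℝ → ℝ) : Measure ℝ :=
  volume.withDensity fun t => ENNReal.ofReal (h t)

lemma integrable_of_mem_densityClass {ς : ℝ → ℝ} {a : ℝ} {h : ℝ → ℝ} (hh : h ∈ densityClass ς a) :
    Integrable h := by
  by_contra hcon
  have := hh.2.2.1
  rw [integral_undef hcon] at this
  exact zero_ne_one this

lemma isProbabilityMeasure_densityLaw {ς : ℝ → ℝ} {a : ℝ} {h : ℝ → ℝ}
    (hh : h ∈ densityClass ς a) : IsProbabilityMeasure (densityLaw h) := by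
  refine ⟨?_⟩
  rw [densityLaw, withDensity_apply _ MeasurableSet.univ, Measure.restrict_univ,
    ← ofReal_integral_eq_lintegral_ofReal (integrable_of_mem_densityClass hh)
      (Filter.Eventually.of_forall hh.2.1), hh.2.2.1, ENNReal.ofReal_one]

lemma exists_forall_fn_mul_le (ς : Activation) {δ : ℝ} (hδ : 0 < δ) :
    ∃ T : ℝ, 0 ≤ T ∧ ∀ t, T < |t| → ς.fn t * (1 - ς.fn t) ≤ δ := by
  cases ς with
  | indicator =>
    refine ⟨0, le_rfl, fun t _ => ?_⟩
    simp only [Activation.fn, Set.indicator_apply, Set.mem_Ici, Pi.one_apply]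
    split_ifs <;> simp [hδ.le]
  | ramp =>
    refine ⟨1 / 2, by norm_num, fun t ht => ?_⟩
    simp only [Activation.fn]
    rcases lt_abs.1 ht with h | h
    · rw [min_eq_right (by linarith), max_eq_left zero_le_one]
      linarith
    · rw [max_eq_right (min_le_of_left_le (by linarith))]
      linarith
  | sigmoid =>
    obtain ⟨N, hN⟩ := Filter.eventually_atBot.1
      (Real.tendsto_sigmoid_atBot.eventually (gt_mem_nhds hδ))
    refine ⟨|N|, abs_nonneg _, fun t ht => ?_⟩
    simp only [Activation.fn]
    have h1 := neg_abs_le N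
    rcases lt_abs.1 ht with h | h
    · have h2 := hN (-t) (by linarith)
      rw [Real.sigmoid_neg] at h2
      nlinarith [Real.sigmoid_pos t, Real.sigmoid_lt_one t]
    · have h2 := hN t (by linarith)
      nlinarith [Real.sigmoid_pos t, Real.sigmoid_lt_one t]

/-- The scale constraint makes the density class uniformly tight. -/
lemma exists_le_densityLaw_Icc (ς : Activation) {a : ℝ} (ha : 0 < a) :
    ∃ T : ℝ, 0 ≤ T ∧ ∀ h ∈ densityClass ς.fn a, a / 2 ≤ (densityLaw h).real (Set.Icc (-T) T) := by
  obtain ⟨T, hT, hψ⟩ := exists_forall_fn_mul_le ς (half_pos ha)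
  refine ⟨T, hT, fun h hh => ?_⟩
  have hi := integrable_of_mem_densityClass hh
  have h1 : (densityLaw h).real (Set.Icc (-T) T) = ∫ t in Set.Icc (-T) T, h t := by
    rw [Measure.real, densityLaw, withDensity_apply _ measurableSet_Icc,
      ← ofReal_integral_eq_lintegral_ofReal hi.integrableOn
        (Filter.Eventually.of_forall hh.2.1), ENNReal.toReal_ofReal]
    exact setIntegral_nonneg measurableSet_Icc fun t _ => hh.2.1 t
  have h2 : a ≤ ∫ t, ((Set.Icc (-T) T).indicator h t + a / 2 * h t) := by
    conv_lhs => rw [← hh.2.2.2]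
    refine integral_mono_of_nonneg (Filter.Eventually.of_forall fun t => ?_)
      ((hi.indicator measurableSet_Icc).add (hi.const_mul _))
      (Filter.Eventually.of_forall fun t => ?_)
    · exact mul_nonneg (mul_nonneg (ς.fn_nonneg t) (sub_nonneg.2 (ς.fn_le_one t))) (hh.2.1 t)
    · have h0 := hh.2.1 t
      simp only [Set.indicator_apply, Set.mem_Icc]
      split_ifs with ht
      · have : ς.fn t * (1 - ς.fn t) ≤ 1 := by
          nlinarith [ς.fn_nonneg t, ς.fn_le_one t]
        nlinarith [mul_nonneg ha.le h0]
      · rw [← abs_le, not_le] at ht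
        have := hψ t ht
        nlinarith
  rw [integral_add (hi.indicator measurableSet_Icc) (hi.const_mul _),
    integral_indicator measurableSet_Icc, integral_const_mul, hh.2.2.1] at h2
  rw [h1]
  linarith

section Elliptical

variable {p : ℕ} {θ : EuclideanSpace ℝ (Fin p)} {S : Matrix (Fin p) (Fin p) ℝ} {h : ℝ → ℝ}
  {P : Measure (EuclideanSpace ℝ (Fin p))} {ς : ℝ → ℝ} {a M : ℝ}

lemma exists_norm_eq_one_smul (hp : 0 < p) (v : EuclideanSpace ℝ (Fin p)) :
    ∃ w : EuclideanSpace ℝ (Fin p), ‖w‖ = 1 ∧ v = ‖v‖ • w := by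
  by_cases hv : v = 0
  · have : Nonempty (Fin p) := ⟨⟨0, hp⟩⟩
    obtain ⟨w, hw⟩ := exists_norm_eq (EuclideanSpace ℝ (Fin p)) zero_le_one
    exact ⟨w, hw, by simp [hv]⟩
  · refine ⟨‖v‖⁻¹ • v, norm_smul_inv_norm hv, ?_⟩
    rw [smul_smul, mul_inv_cancel₀ (norm_ne_zero_iff.2 hv), one_smul]

/-- Linear projections of an elliptical law are symmetric scale transforms of the law with
density `h`. -/
lemma IsElliptical.exists_projection_eq (hP : IsElliptical θ S h P) (hh : h ∈ densityClass ς a)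
    (hS : S ∈ scatterClass p M) (hp : 0 < p) {u : EuclideanSpace ℝ (Fin p)} (hu : ‖u‖ = 1) :
    IsProbabilityMeasure P ∧ ∃ s : ℝ, 0 ≤ s ∧ s ≤ √M ∧
      (P.map fun x => inner ℝ u (x - θ)) = (densityLaw h).map (fun z => s * z) ∧
      (P.map fun x => -inner ℝ u (x - θ)) = (densityLaw h).map (fun z => s * z) := by
  obtain ⟨A, ν, hAS, hν, -, hproj, rfl⟩ := hP
  set L := Matrix.toEuclideanCLM (n := Fin p) (𝕜 := ℝ) A with hL
  set μ := ν.prod (uniformSphere p) with hμ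
  have hHprob := isProbabilityMeasure_densityLaw hh
  have hm : Measurable fun q : ℝ × Metric.sphere (0 : EuclideanSpace ℝ (Fin p)) 1 =>
      θ + q.1 • L q.2.1 := by fun_prop
  have hμprob : IsProbabilityMeasure μ := by
    obtain ⟨w, hw, -⟩ := exists_norm_eq_one_smul hp (0 : EuclideanSpace ℝ (Fin p))
    refine ⟨?_⟩
    have h1 := congrArg (fun m : Measure ℝ => m Set.univ) (hproj w hw)
    rw [Measure.map_apply (by fun_prop) MeasurableSet.univ, Set.preimage_univ] at h1
    exact h1.trans hHprob.measure_univ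
  refine ⟨Measure.isProbabilityMeasure_map hm.aemeasurable, ?_⟩
  set v := ContinuousLinearMap.adjoint L u with hv
  obtain ⟨w, hw, hvw⟩ := exists_norm_eq_one_smul hp v
  have hadj : ContinuousLinearMap.adjoint L =
      Matrix.toEuclideanCLM (n := Fin p) (𝕜 := ℝ) A.transpose := by
    rw [← ContinuousLinearMap.star_eq_adjoint, hL, ← map_star, Matrix.star_eq_conjTranspose,
      Matrix.conjTranspose_eq_transpose_of_trivial]
  have hinner : ∀ q : ℝ × Metric.sphere (0 : EuclideanSpace ℝ (Fin p)) 1,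
      inner ℝ u (θ + q.1 • L q.2.1 - θ) = ‖v‖ * (q.1 * inner ℝ w q.2.1) := by
    intro q
    rw [add_sub_cancel_left, real_inner_smul_right, ← ContinuousLinearMap.adjoint_inner_left, ← hv]
    conv_lhs => rw [hvw]
    rw [real_inner_smul_left]
    ring
  refine ⟨‖v‖, norm_nonneg _, ?_, ?_, ?_⟩
  · refine Real.le_sqrt_of_sq_le ?_
    have h1 : ‖v‖ ^ 2 = inner ℝ u (Matrix.toEuclideanCLM (n := Fin p) (𝕜 := ℝ) S u) := by
      rw [← real_inner_self_eq_norm_sq, hv, ContinuousLinearMap.adjoint_inner_left, hadj, hL,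
        ← hAS, map_mul]
      rfl
    rw [h1]
    calc inner ℝ u (Matrix.toEuclideanCLM (n := Fin p) (𝕜 := ℝ) S u)
        ≤ ‖u‖ * ‖Matrix.toEuclideanCLM (n := Fin p) (𝕜 := ℝ) S u‖ := real_inner_le_norm _ _
      _ ≤ ‖u‖ * (‖Matrix.toEuclideanCLM (n := Fin p) (𝕜 := ℝ) S‖ * ‖u‖) := by
          gcongr
          exact ContinuousLinearMap.le_opNorm _ _
      _ ≤ M := by rw [hu, one_mul, mul_one]; exact hS.2
  · rw [Measure.map_map (by fun_prop) hm, densityLaw, ← hproj w hw,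
      Measure.map_map (by fun_prop) (by fun_prop)]
    congr 1
    ext q
    exact hinner q
  · rw [Measure.map_map (by fun_prop) hm, densityLaw, ← hproj (-w) (by rwa [norm_neg]),
      Measure.map_map (by fun_prop) (by fun_prop)]
    congr 1
    ext q
    simp only [Function.comp_apply, hinner, inner_neg_left, mul_neg]

end Elliptical

lemma integrable_ridge {p : ℕ} (σ : Activation) (P : Measure (EuclideanSpace ℝ (Fin p)))
    [IsFiniteMeasure P] (u : EuclideanSpace ℝ (Fin p)) (b : ℝ) :
    Integrable (fun y => σ.fn (inner ℝ u y + b)) P := by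
  have hσ := σ.measurable_fn
  refine Integrable.of_bound (C := 1) (Measurable.aestronglyMeasurable (by fun_prop))
    (Filter.Eventually.of_forall fun y => ?_)
  rw [Real.norm_eq_abs, abs_of_nonneg (σ.fn_nonneg _)]
  exact σ.fn_le_one _

lemma integrable_fn_mul_add (σ : Activation) (H : Measure ℝ) [IsFiniteMeasure H] (s b : ℝ) :
    Integrable (fun z => σ.fn (s * z + b)) H := by
  have hσ := σ.measurable_fn
  refine Integrable.of_bound (C := 1) (Measurable.aestronglyMeasurable (by fun_prop))
    (Filter.Eventually.of_forall fun y => ?_)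
  rw [Real.norm_eq_abs, abs_of_nonneg (σ.fn_nonneg _)]
  exact σ.fn_le_one _

/-- Along a unit vector, the ridge function expectations of an elliptical law are those of a
scale transform of the law with density `h`, recentred at the location. -/
lemma IsElliptical.exists_integral_ridge_eq {p : ℕ} {θ : EuclideanSpace ℝ (Fin p)}
    {S : Matrix (Fin p) (Fin p) ℝ} {h : ℝ → ℝ} {P : Measure (EuclideanSpace ℝ (Fin p))}
    {ς : ℝ → ℝ} {a M : ℝ} (σ : Activation) (hP : IsElliptical θ S h P)
    (hh : h ∈ densityClass ς a) (hS : S ∈ scatterClass p M) (hp : 0 < p)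
    {u : EuclideanSpace ℝ (Fin p)} (hu : ‖u‖ = 1) :
    ∃ s : ℝ, 0 ≤ s ∧ s ≤ √M ∧
      (∀ b, ∫ x, σ.fn (inner ℝ u x + b) ∂P =
        ∫ z, σ.fn (s * z + (b + inner ℝ u θ)) ∂(densityLaw h)) ∧
      ∀ b, ∫ x, σ.fn (inner ℝ (-u) x + b) ∂P =
        ∫ z, σ.fn (s * z + (b - inner ℝ u θ)) ∂(densityLaw h) := by
  obtain ⟨-, s, hs₀, hs₁, h₁, h₂⟩ := hP.exists_projection_eq hh hS hp hu
  have hσ := σ.measurable_fn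
  refine ⟨s, hs₀, hs₁, fun b => ?_, fun b => ?_⟩
  · have h3 := integral_map (μ := densityLaw h) (φ := fun z => s * z) (by fun_prop)
      (f := fun w => σ.fn (w + (b + inner ℝ u θ))) (Measurable.aestronglyMeasurable (by fun_prop))
    rw [← h₁, integral_map (by fun_prop) (Measurable.aestronglyMeasurable (by fun_prop))] at h3
    rw [← h3]
    refine integral_congr_ae (Filter.Eventually.of_forall fun x => ?_)
    simp only [inner_sub_right]
    congr 1
    ring
  · have h3 := integral_map (μ := densityLaw h) (φ := fun z => s * z) (by fun_prop)
      (f := fun w => σ.fn (w + (b - inner ℝ u θ))) (Measurable.aestronglyMeasurable (by fun_prop))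
    rw [← h₂, integral_map (by fun_prop) (Measurable.aestronglyMeasurable (by fun_prop))] at h3
    rw [← h3]
    refine integral_congr_ae (Filter.Eventually.of_forall fun x => ?_)
    simp only [inner_sub_right, inner_neg_left]
    congr 1
    ring

/-- A monotone function which increases by little over each step of length `2Δ` takes many steps
to increase by much. -/
lemma mul_sub_le_of_increment_le {φ : ℝ → ℝ} (hφ : Monotone φ) {Δ δ T γ : ℝ} (hΔ : 0 < Δ)
    (hT : 0 ≤ T) (hδ : 0 ≤ δ) (hinc : ∀ b, φ (b + 2 * Δ) ≤ φ b + 2 * δ)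
    (hγ : γ ≤ φ T - φ (-T)) : γ * Δ ≤ 2 * δ * (T + Δ) := by
  have hk : ∀ k : ℕ, φ (-T + k * (2 * Δ)) ≤ φ (-T) + k * (2 * δ) := by
    intro k
    induction k with
    | zero => simp
    | succ k ih =>
      have h1 := hinc (-T + k * (2 * Δ))
      rw [show -T + ((k + 1 : ℕ) : ℝ) * (2 * Δ) = -T + k * (2 * Δ) + 2 * Δ by push_cast; ring]
      push_cast
      linarith
  have h1 := Nat.le_ceil (T / Δ)
  have h2 := (Nat.ceil_lt_add_one (a := T / Δ) (by positivity)).le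
  rw [div_le_iff₀ hΔ] at h1
  have h3 := hφ (show T ≤ -T + (⌈T / Δ⌉₊ : ℝ) * (2 * Δ) by linarith)
  have h4 := hk ⌈T / Δ⌉₊
  have h5 : γ ≤ (T / Δ + 1) * (2 * δ) :=
    (by linarith : γ ≤ (⌈T / Δ⌉₊ : ℝ) * (2 * δ)).trans (by gcongr)
  calc γ * Δ ≤ (T / Δ + 1) * (2 * δ) * Δ := by gcongr
    _ = _ := by field_simp

/-- The location of an elliptical law is identified, at a linear rate, by the expectations of
ridge functions. -/
lemma exists_norm_sub_le_of_ridge_close (σ ς : Activation) {a M : ℝ} (ha : 0 < a) :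
    ∃ δ₀ C : ℝ, 0 < δ₀ ∧ 0 < C ∧ ∀ (p : ℕ), 0 < p → ∀ (θ θ' : EuclideanSpace ℝ (Fin p)),
      ∀ S ∈ scatterClass p M, ∀ S' ∈ scatterClass p M,
      ∀ h ∈ densityClass ς.fn a, ∀ h' ∈ densityClass ς.fn a,
      ∀ (P P' : Measure (EuclideanSpace ℝ (Fin p))), IsElliptical θ S h P →
        IsElliptical θ' S' h' P' → ∀ δ, 0 ≤ δ → δ ≤ δ₀ →
        (∀ (u : EuclideanSpace ℝ (Fin p)) (b : ℝ),
          |∫ x, σ.fn (inner ℝ u x + b) ∂P - ∫ x, σ.fn (inner ℝ u x + b) ∂P'| ≤ δ) →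
        ‖θ' - θ‖ ≤ C * δ := by
  obtain ⟨T₀, hT₀, htight⟩ := exists_le_densityLaw_Icc ς ha
  set T := √M * T₀ + 2 with hTdef
  have hT : 0 < T := by positivity
  set γ := a / 2 * (σ.fn 2 - σ.fn (-2)) with hγdef
  have hγ₀ : 0 < γ := mul_pos (by linarith) (sub_pos.2 σ.fn_neg_two_lt_fn_two)
  refine ⟨γ / 4, 4 * T / γ, by positivity, by positivity, ?_⟩
  intro p hp θ θ' S hS S' hS' h hh h' hh' P P' hP hP' δ hδ hδ₀ hclose
  rcases eq_or_ne θ' θ with rfl | hne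
  · rw [sub_self, norm_zero]; positivity
  set Δ := ‖θ' - θ‖ with hΔdef
  have hΔ : 0 < Δ := norm_pos_iff.2 (sub_ne_zero.2 hne)
  set u := Δ⁻¹ • (θ' - θ) with hudef
  have hu : ‖u‖ = 1 := norm_smul_inv_norm (sub_ne_zero.2 hne)
  have huθ : inner ℝ u θ' = inner ℝ u θ + Δ := by
    have : inner ℝ u (θ' - θ) = Δ := by
      rw [hudef, real_inner_smul_left, real_inner_self_eq_norm_sq, ← hΔdef]
      field_simp
    rw [inner_sub_right] at this
    linarith
  obtain ⟨s, hs₀, hs₁, hφ₁, hφ₂⟩ := hP.exists_integral_ridge_eq σ hh hS hp hu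
  obtain ⟨s', -, -, hψ₁, hψ₂⟩ := hP'.exists_integral_ridge_eq σ hh' hS' hp hu
  have hprob := isProbabilityMeasure_densityLaw hh
  set φ : ℝ → ℝ := fun b => ∫ z, σ.fn (s * z + b) ∂(densityLaw h) with hφdef
  set ψ : ℝ → ℝ := fun b => ∫ z, σ.fn (s' * z + b) ∂(densityLaw h') with hψdef
  have h1 : ∀ b, |φ b - ψ (b + Δ)| ≤ δ := by
    intro b
    have h2 := hclose u (b - inner ℝ u θ)
    rw [hφ₁, hψ₁, huθ] at h2
    convert h2 using 4 <;> ring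
  have h2 : ∀ b, |φ b - ψ (b - Δ)| ≤ δ := by
    intro b
    have h3 := hclose (-u) (b + inner ℝ u θ)
    rw [hφ₂, hψ₂, huθ] at h3
    convert h3 using 4 <;> ring
  have hinc : ∀ b, φ (b + 2 * Δ) ≤ φ b + 2 * δ := by
    intro b
    have h3 := (abs_le.1 (h1 b)).1
    have h4 := (abs_le.1 (h2 (b + 2 * Δ))).2
    rw [show b + 2 * Δ - Δ = b + Δ by ring] at h4
    linarith
  have hmono : Monotone φ := fun b c hbc => integral_mono (integrable_fn_mul_add σ _ s b)
    (integrable_fn_mul_add σ _ s c) fun z => σ.monotone_fn (by linarith)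
  have hrise : γ ≤ φ T - φ (-T) := by
    rw [hφdef]
    beta_reduce
    rw [← integral_sub (integrable_fn_mul_add σ _ s T) (integrable_fn_mul_add σ _ s (-T))]
    calc γ ≤ (densityLaw h).real (Set.Icc (-T₀) T₀) * (σ.fn 2 - σ.fn (-2)) := by
          rw [hγdef]
          exact mul_le_mul_of_nonneg_right (htight h hh)
            (sub_pos.2 σ.fn_neg_two_lt_fn_two).le
      _ = ∫ z, (Set.Icc (-T₀) T₀).indicator (fun _ => σ.fn 2 - σ.fn (-2)) z ∂(densityLaw h) := by
          rw [integral_indicator_const _ measurableSet_Icc, smul_eq_mul]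
      _ ≤ _ := by
          refine integral_mono ((integrable_const _).indicator measurableSet_Icc)
            ((integrable_fn_mul_add σ _ s T).sub (integrable_fn_mul_add σ _ s (-T))) fun z => ?_
          by_cases hz : z ∈ Set.Icc (-T₀) T₀
          · rw [Set.indicator_of_mem hz]
            have h5 : |s * z| ≤ √M * T₀ := by
              rw [abs_mul, abs_of_nonneg hs₀]
              exact mul_le_mul hs₁ (abs_le.2 hz) (abs_nonneg _) (Real.sqrt_nonneg _)
            have h6 := abs_le.1 h5
            exact sub_le_sub (σ.monotone_fn (by linarith [h6.1]))
              (σ.monotone_fn (by linarith [h6.2]))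
          · rw [Set.indicator_of_notMem hz]
            exact sub_nonneg.2 (σ.monotone_fn (by linarith))
  have hfin := mul_sub_le_of_increment_le hmono hΔ hT.le hδ hinc hrise
  rw [div_mul_eq_mul_div, le_div_iff₀ hγ₀]
  nlinarith

lemma log_sigmoid_eq (t : ℝ) :
    Real.log (Real.sigmoid t) = -Real.log 2 + t / 2 - Real.log (Real.cosh (t / 2)) := by
  have h1 : Real.sigmoid t = Real.exp (t / 2) / (2 * Real.cosh (t / 2)) := by
    rw [Real.sigmoid_def, Real.cosh_eq, eq_div_iff (by positivity), inv_mul_eq_div,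
      div_eq_iff (by positivity), mul_add, mul_one, ← Real.exp_add]
    rw [show t / 2 + -t = -(t / 2) by ring]
    ring
  rw [h1, Real.log_div (Real.exp_pos _).ne' (by have := Real.cosh_pos (t / 2); positivity),
    Real.log_exp, Real.log_mul (by norm_num) (Real.cosh_pos _).ne']
  ring

lemma log_sigmoid_le (t : ℝ) : Real.log (Real.sigmoid t) ≤ -Real.log 2 + t / 2 := by
  rw [log_sigmoid_eq]
  linarith [Real.log_nonneg (Real.one_le_cosh (t / 2))]

lemma le_log_sigmoid (t : ℝ) :
    -Real.log 2 + t / 2 - t ^ 2 / 8 ≤ Real.log (Real.sigmoid t) := by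
  rw [log_sigmoid_eq]
  have h1 := Real.log_le_log (Real.cosh_pos _) (Real.cosh_le_exp_half_sq (t / 2))
  rw [Real.log_exp] at h1
  nlinarith

section Criterion

variable {n p : ℕ} {κ : ℝ}

/-- The value of the criterion at one discriminator with logit `f`, up to a quadratic error. -/
lemma criterion_value_bounds (hn : 0 < n) (P : Measure (EuclideanSpace ℝ (Fin p)))
    [IsProbabilityMeasure P] (x : Fin n → EuclideanSpace ℝ (Fin p))
    {f : EuclideanSpace ℝ (Fin p) → ℝ} (hf : Measurable f) (hfκ : ∀ y, |f y| ≤ κ) :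
    (1 / (n : ℝ) * ∑ i, Real.log (Real.sigmoid (f (x i))) +
        ∫ y, Real.log (1 - Real.sigmoid (f y)) ∂P) + Real.log 4 ≤
      (1 / (n : ℝ) * ∑ i, f (x i) - ∫ y, f y ∂P) / 2 ∧
    (1 / (n : ℝ) * ∑ i, f (x i) - ∫ y, f y ∂P) / 2 - κ ^ 2 / 4 ≤
      (1 / (n : ℝ) * ∑ i, Real.log (Real.sigmoid (f (x i))) +
        ∫ y, Real.log (1 - Real.sigmoid (f y)) ∂P) + Real.log 4 := by
  have hn' : (0 : ℝ) < n := by exact_mod_cast hn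
  have hlog4 : Real.log 4 = 2 * Real.log 2 := by
    rw [show (4 : ℝ) = 2 ^ 2 by norm_num, Real.log_pow]; norm_num
  have hsq : ∀ y, f y ^ 2 ≤ κ ^ 2 := fun y => sq_le_sq' (abs_le.1 (hfκ y)).1 (abs_le.1 (hfκ y)).2
  have hfi : Integrable f P := Integrable.of_bound hf.aestronglyMeasurable κ
    (Filter.Eventually.of_forall hfκ)
  have hlow : ∀ y, -Real.log 2 - f y / 2 - κ ^ 2 / 8 ≤ Real.log (1 - Real.sigmoid (f y)) := by
    intro y
    rw [← Real.sigmoid_neg]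
    have h1 := le_log_sigmoid (-f y)
    have h2 := hsq y
    rw [neg_sq] at h1
    linarith
  have hhigh : ∀ y, Real.log (1 - Real.sigmoid (f y)) ≤ -Real.log 2 - f y / 2 := by
    intro y
    rw [← Real.sigmoid_neg]
    have h1 := log_sigmoid_le (-f y)
    linarith
  have hgm : Measurable fun y => Real.log (1 - Real.sigmoid (f y)) :=
    Real.measurable_log.comp (measurable_const.sub (continuous_sigmoid.measurable.comp hf))
  have hgi : Integrable (fun y => Real.log (1 - Real.sigmoid (f y))) P := by
    refine Integrable.of_bound hgm.aestronglyMeasurable (Real.log 2 + κ / 2 + κ ^ 2 / 8)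
      (Filter.Eventually.of_forall fun y => ?_)
    rw [Real.norm_eq_abs, abs_le]
    have h1 := abs_le.1 (hfκ y)
    have h2 := Real.log_nonneg (by norm_num : (1 : ℝ) ≤ 2)
    constructor <;> nlinarith [hlow y, hhigh y]
  have hc : ∀ c : ℝ, ∫ _, c ∂P = c := fun c => by simp
  have hI₁ : ∫ y, Real.log (1 - Real.sigmoid (f y)) ∂P ≤ -Real.log 2 - (∫ y, f y ∂P) / 2 := by
    have h1 := integral_mono hgi ((integrable_const (-Real.log 2)).sub (hfi.div_const 2)) hhigh
    simp only [Pi.sub_apply] at h1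
    rwa [integral_sub (integrable_const _) (hfi.div_const 2), hc, integral_div] at h1
  have hI₂ : -Real.log 2 - κ ^ 2 / 8 - (∫ y, f y ∂P) / 2 ≤
      ∫ y, Real.log (1 - Real.sigmoid (f y)) ∂P := by
    have h1 := integral_mono ((integrable_const (-Real.log 2 - κ ^ 2 / 8)).sub (hfi.div_const 2))
      hgi fun y => by simp only [Pi.sub_apply]; linarith [hlow y]
    simp only [Pi.sub_apply] at h1
    rwa [integral_sub (integrable_const _) (hfi.div_const 2), hc, integral_div] at h1
  have hS₁ : 1 / (n : ℝ) * ∑ i, Real.log (Real.sigmoid (f (x i))) ≤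
      -Real.log 2 + (1 / (n : ℝ) * ∑ i, f (x i)) / 2 := by
    have h1 : ∑ i, Real.log (Real.sigmoid (f (x i))) ≤ ∑ i, (-Real.log 2 + f (x i) / 2) :=
      Finset.sum_le_sum fun i _ => log_sigmoid_le _
    rw [Finset.sum_add_distrib, ← Finset.sum_div, Finset.sum_const, Finset.card_univ,
      Fintype.card_fin, nsmul_eq_mul] at h1
    calc 1 / (n : ℝ) * ∑ i, Real.log (Real.sigmoid (f (x i)))
        ≤ 1 / (n : ℝ) * (n * -Real.log 2 + (∑ i, f (x i)) / 2) := by gcongr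
      _ = _ := by field_simp
  have hS₂ : -Real.log 2 - κ ^ 2 / 8 + (1 / (n : ℝ) * ∑ i, f (x i)) / 2 ≤
      1 / (n : ℝ) * ∑ i, Real.log (Real.sigmoid (f (x i))) := by
    have h1 : ∑ i, (-Real.log 2 - κ ^ 2 / 8 + f (x i) / 2) ≤
        ∑ i, Real.log (Real.sigmoid (f (x i))) :=
      Finset.sum_le_sum fun i _ => by linarith [le_log_sigmoid (f (x i)), hsq (x i)]
    rw [Finset.sum_add_distrib, ← Finset.sum_div, Finset.sum_const, Finset.card_univ,
      Fintype.card_fin, nsmul_eq_mul] at h1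
    calc -Real.log 2 - κ ^ 2 / 8 + (1 / (n : ℝ) * ∑ i, f (x i)) / 2
        = 1 / (n : ℝ) * (n * (-Real.log 2 - κ ^ 2 / 8) + (∑ i, f (x i)) / 2) := by
          field_simp
      _ ≤ _ := by gcongr
  rw [hlog4]
  exact ⟨by linarith, by linarith⟩

lemma measurable_logit (σ : Activation) {N : ℕ} (w : Fin N → ℝ)
    (u : Fin N → EuclideanSpace ℝ (Fin p)) (b : Fin N → ℝ) :
    Measurable fun y => ∑ j, w j * σ.fn (inner ℝ (u j) y + b j) := by
  have := σ.measurable_fn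
  fun_prop

lemma abs_logit_le (σ : Activation) {N : ℕ} {w : Fin N → ℝ} (hw : ∑ j, |w j| ≤ κ)
    (u : Fin N → EuclideanSpace ℝ (Fin p)) (b : Fin N → ℝ) (y : EuclideanSpace ℝ (Fin p)) :
    |∑ j, w j * σ.fn (inner ℝ (u j) y + b j)| ≤ κ := by
  refine (Finset.abs_sum_le_sum_abs _ _).trans (le_trans (Finset.sum_le_sum fun j _ => ?_) hw)
  rw [abs_mul, abs_of_nonneg (σ.fn_nonneg _)]
  exact mul_le_of_le_one_right (abs_nonneg _) (σ.fn_le_one _)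

lemma discriminator_value_le (σ : Activation) (hn : 0 < n)
    (P : Measure (EuclideanSpace ℝ (Fin p))) [IsProbabilityMeasure P]
    (x : Fin n → EuclideanSpace ℝ (Fin p)) {s : ℝ} (hs : 0 ≤ s)
    (h : ∀ (u : EuclideanSpace ℝ (Fin p)) (b : ℝ),
      |1 / (n : ℝ) * ∑ i, σ.fn (inner ℝ u (x i) + b) - ∫ y, σ.fn (inner ℝ u y + b) ∂P| ≤ s)
    {D : EuclideanSpace ℝ (Fin p) → ℝ} (hD : D ∈ discriminatorClass p σ.fn κ) :
    (1 / (n : ℝ) * ∑ i, Real.log (D (x i)) + ∫ y, Real.log (1 - D y) ∂P) + Real.log 4 ≤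
      κ * s / 2 := by
  obtain ⟨N, w, u, b, hw, rfl⟩ := hD
  refine (criterion_value_bounds hn P x (measurable_logit σ w u b) (abs_logit_le σ hw u b)).1.trans
    ?_
  have h1 : 1 / (n : ℝ) * ∑ i, ∑ j, w j * σ.fn (inner ℝ (u j) (x i) + b j) -
      ∫ y, ∑ j, w j * σ.fn (inner ℝ (u j) y + b j) ∂P =
      ∑ j, w j * (1 / (n : ℝ) * ∑ i, σ.fn (inner ℝ (u j) (x i) + b j) -
        ∫ y, σ.fn (inner ℝ (u j) y + b j) ∂P) := by
    rw [integral_finsetSum _ fun j _ => (integrable_ridge σ P (u j) (b j)).const_mul _,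
      Finset.sum_comm, Finset.mul_sum, ← Finset.sum_sub_distrib]
    refine Finset.sum_congr rfl fun j _ => ?_
    rw [integral_const_mul, ← Finset.mul_sum]
    ring
  rw [h1]
  have h2 : ∑ j, w j * (1 / (n : ℝ) * ∑ i, σ.fn (inner ℝ (u j) (x i) + b j) -
        ∫ y, σ.fn (inner ℝ (u j) y + b j) ∂P) ≤ ∑ j, |w j| * s := by
    refine Finset.sum_le_sum fun j _ => (le_abs_self _).trans ?_
    rw [abs_mul]
    exact mul_le_mul_of_nonneg_left (h _ _) (abs_nonneg _)
  rw [← Finset.sum_mul] at h2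
  have h3 : (∑ j, |w j|) * s ≤ κ * s := by gcongr
  linarith

lemma jsCriterion_le (σ : Activation) (hn : 0 < n) (hκ : 0 < κ)
    (P : Measure (EuclideanSpace ℝ (Fin p))) [IsProbabilityMeasure P]
    (x : Fin n → EuclideanSpace ℝ (Fin p)) {s : ℝ} (hs : 0 ≤ s)
    (h : ∀ (u : EuclideanSpace ℝ (Fin p)) (b : ℝ),
      |1 / (n : ℝ) * ∑ i, σ.fn (inner ℝ u (x i) + b) - ∫ y, σ.fn (inner ℝ u y + b) ∂P| ≤ s) :
    jsCriterion σ.fn κ x P ≤ κ * s / 2 := by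
  rw [jsCriterion, ← le_sub_iff_add_le]
  refine csSup_le (Set.Nonempty.image _ ⟨_, 0, fun _ => 0, fun _ => 0, fun _ => 0, by
    simpa using hκ.le, rfl⟩) ?_
  rintro _ ⟨D, hD, rfl⟩
  rw [le_sub_iff_add_le]
  exact discriminator_value_le σ hn P x hs h hD

lemma abs_mean_sub_integral_le_one (σ : Activation) (hn : 0 < n)
    (P : Measure (EuclideanSpace ℝ (Fin p))) [IsProbabilityMeasure P]
    (x : Fin n → EuclideanSpace ℝ (Fin p)) (u : EuclideanSpace ℝ (Fin p)) (b : ℝ) :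
    |1 / (n : ℝ) * ∑ i, σ.fn (inner ℝ u (x i) + b) - ∫ y, σ.fn (inner ℝ u y + b) ∂P| ≤ 1 := by
  have hn' : (0 : ℝ) < n := by exact_mod_cast hn
  refine abs_sub_le_of_nonneg_of_le ?_ ?_ (integral_nonneg fun _ => σ.fn_nonneg _) ?_
  · exact mul_nonneg (by positivity) (Finset.sum_nonneg fun _ _ => σ.fn_nonneg _)
  · rw [one_div, inv_mul_le_iff₀ hn', mul_one]
    refine (Finset.sum_le_sum fun i _ => σ.fn_le_one _).trans ?_
    simp
  · refine (integral_mono (integrable_ridge σ P u b) (integrable_const 1)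
      fun _ => σ.fn_le_one _).trans ?_
    simp

lemma le_jsCriterion (σ : Activation) (hn : 0 < n) (hκ : 0 < κ)
    (P : Measure (EuclideanSpace ℝ (Fin p))) [IsProbabilityMeasure P]
    (x : Fin n → EuclideanSpace ℝ (Fin p)) (u : EuclideanSpace ℝ (Fin p)) (b : ℝ) :
    κ * |1 / (n : ℝ) * ∑ i, σ.fn (inner ℝ u (x i) + b) - ∫ y, σ.fn (inner ℝ u y + b) ∂P| / 2 -
      κ ^ 2 / 4 ≤ jsCriterion σ.fn κ x P := by
  have hbdd : BddAbove ((fun D : EuclideanSpace ℝ (Fin p) → ℝ =>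
      (1 / (n : ℝ)) * ∑ i, Real.log (D (x i)) + ∫ y, Real.log (1 - D y) ∂P) ''
      discriminatorClass p σ.fn κ) := by
    refine ⟨κ * 1 / 2 - Real.log 4, ?_⟩
    rintro _ ⟨D, hD, rfl⟩
    rw [le_sub_iff_add_le]
    exact discriminator_value_le σ hn P x zero_le_one (abs_mean_sub_integral_le_one σ hn P x) hD
  have hone : ∀ w : ℝ, |w| ≤ κ → w * (1 / (n : ℝ) * ∑ i, σ.fn (inner ℝ u (x i) + b) -
      ∫ y, σ.fn (inner ℝ u y + b) ∂P) / 2 - κ ^ 2 / 4 ≤ jsCriterion σ.fn κ x P := by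
    intro w hw
    have hσ := σ.measurable_fn
    have h1 := (criterion_value_bounds (κ := κ) hn P x
      (f := fun y => w * σ.fn (inner ℝ u y + b)) (by fun_prop) fun y => by
        rw [abs_mul, abs_of_nonneg (σ.fn_nonneg _)]
        exact (mul_le_of_le_one_right (abs_nonneg _) (σ.fn_le_one _)).trans hw).2
    rw [integral_const_mul, ← Finset.mul_sum] at h1
    have h2 := le_csSup hbdd (Set.mem_image_of_mem _
      (show (fun y => Real.sigmoid (w * σ.fn (inner ℝ u y + b))) ∈ discriminatorClass p σ.fn κ from
        ⟨1, fun _ => w, fun _ => u, fun _ => b, by simpa using hw, by simp⟩))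
    rw [jsCriterion]
    refine le_trans (le_of_eq ?_) (h1.trans (add_le_add_left h2 _))
    ring
  rcases le_total 0 (1 / (n : ℝ) * ∑ i, σ.fn (inner ℝ u (x i) + b) -
      ∫ y, σ.fn (inner ℝ u y + b) ∂P) with h | h
  · rw [abs_of_nonneg h]
    exact hone κ (abs_of_pos hκ).le
  · rw [abs_of_nonpos h]
    refine le_trans (le_of_eq ?_) (hone (-κ) (by rw [abs_neg, abs_of_pos hκ]))
    ring

end Criterion

lemma isProbabilityMeasure_contaminate {E : Type*} [MeasurableSpace E] {ε : ℝ} (hε₀ : 0 ≤ ε)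
    (hε₁ : ε ≤ 1) (P Q : Measure E) [IsProbabilityMeasure P] [IsProbabilityMeasure Q] :
    IsProbabilityMeasure (contaminate ε P Q) := by
  refine ⟨?_⟩
  rw [contaminate, Measure.add_apply, Measure.smul_apply, Measure.smul_apply, measure_univ,
    measure_univ, smul_eq_mul, smul_eq_mul, mul_one, mul_one,
    ← ENNReal.ofReal_add (by linarith) hε₀, sub_add_cancel, ENNReal.ofReal_one]

lemma abs_integral_contaminate_sub_le {E : Type*} [MeasurableSpace E] {ε : ℝ} (hε₀ : 0 ≤ ε)
    (hε₁ : ε ≤ 1) (P Q : Measure E) [IsProbabilityMeasure P] [IsProbabilityMeasure Q] {f : E → ℝ}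
    (hf : Measurable f) (h₀ : ∀ x, 0 ≤ f x) (h₁ : ∀ x, f x ≤ 1) :
    |∫ x, f x ∂(contaminate ε P Q) - ∫ x, f x ∂P| ≤ ε := by
  have hi : ∀ μ : Measure E, IsProbabilityMeasure μ → Integrable f μ := fun μ _ =>
    Integrable.of_bound hf.aestronglyMeasurable 1 (Filter.Eventually.of_forall fun x => by
      rw [Real.norm_eq_abs, abs_of_nonneg (h₀ x)]; exact h₁ x)
  have hle : ∀ μ : Measure E, IsProbabilityMeasure μ → (∫ x, f x ∂μ) ≤ 1 := fun μ hμ => by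
    refine (integral_mono (hi μ hμ) (integrable_const 1) h₁).trans ?_
    simp
  rw [contaminate, integral_add_measure ((hi P ‹_›).smul_measure ENNReal.ofReal_ne_top)
    ((hi Q ‹_›).smul_measure ENNReal.ofReal_ne_top), integral_smul_measure, integral_smul_measure,
    ENNReal.toReal_ofReal (by linarith), ENNReal.toReal_ofReal hε₀, smul_eq_mul, smul_eq_mul]
  rw [show (1 - ε) * ∫ x, f x ∂P + ε * ∫ x, f x ∂Q - ∫ x, f x ∂P =
    ε * (∫ x, f x ∂Q - ∫ x, f x ∂P) by ring, abs_mul, abs_of_nonneg hε₀]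
  exact mul_le_of_le_one_right hε₀ (abs_sub_le_of_nonneg_of_le (integral_nonneg h₀) (hle Q ‹_›)
    (integral_nonneg h₀) (hle P ‹_›))

lemma exists_norm_eq_one {p : ℕ} (hp : 0 < p) :
    ∃ w : EuclideanSpace ℝ (Fin p), ‖w‖ = 1 := by
  obtain ⟨w, hw, -⟩ := exists_norm_eq_one_smul hp (0 : EuclideanSpace ℝ (Fin p))
  exact ⟨w, hw⟩

/-- `σ` is the activation of the discriminators and `ς` the one that fixes the scale of the
densities. The observations are i.i.d., so that their joint law is a product measure. -/
theorem theorem4 (σ ς : Activation) (a M K : ℝ) (ha₀ : 0 < a) (ha₁ : a < 1 / 4)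
    (hM : 0 < M) (hK : 0 < K) :
    ∃ c C C' : ℝ, 0 < c ∧ 0 < C ∧ 0 < C' ∧
      ∀ (n p : ℕ), 0 < n → 0 < p →
      ∀ ε : ℝ, 0 ≤ ε → ε ≤ 1 → (p : ℝ) / n + ε ^ 2 ≤ c →
      ∀ κ : ℝ, 0 < κ → κ ≤ K * (√((p : ℝ) / n) + ε) →
      ∀ τ : ℝ, 0 ≤ τ → τ ≤ K * κ * (√((p : ℝ) / n) + ε) →
      ∀ (θ : EuclideanSpace ℝ (Fin p)), ∀ S ∈ scatterClass p M, ∀ h ∈ densityClass ς.fn a,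
      ∀ (P Q : Measure (EuclideanSpace ℝ (Fin p))), IsElliptical θ S h P →
        IsProbabilityMeasure Q →
        ∃ E : Set (Fin n → EuclideanSpace ℝ (Fin p)), MeasurableSet E ∧
          1 - Real.exp (-(C' * (p + n * ε ^ 2))) ≤
            (Measure.pi fun _ : Fin n => contaminate ε P Q).real E ∧
          ∀ x ∈ E, ∀ θhat : EuclideanSpace ℝ (Fin p),
            IsJSGANEstimate σ.fn ς.fn a M κ τ x θhat →
            ‖θhat - θ‖ ^ 2 ≤ C * max ((p : ℝ) / n) (ε ^ 2) := by
  obtain ⟨δ₀, C₀, hδ₀, hC₀, hident⟩ := exists_norm_sub_le_of_ridge_close (M := M) σ ς ha₀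
  set B := 322 + 3 * K with hB
  have hBpos : 0 < B := by positivity
  refine ⟨(δ₀ / B) ^ 2 / 2, 4 * (C₀ * B) ^ 2, 1, by positivity, by positivity, one_pos, ?_⟩
  intro n p hn hp ε hε₀ hε₁ hc κ hκ hκK τ hτ hτK θ S hS h hh P Q hP hQ
  have hn' : (0 : ℝ) < n := by exact_mod_cast hn
  have hp' : (0 : ℝ) < p := by exact_mod_cast hp
  set t := √((p : ℝ) / n) + ε with htdef
  have hr : 0 < √((p : ℝ) / n) := Real.sqrt_pos.2 (by positivity)
  have hr2 : √((p : ℝ) / n) ^ 2 = p / n := Real.sq_sqrt (by positivity)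
  have ht : 0 < t := by positivity
  have ht2 : (p : ℝ) + n * ε ^ 2 ≤ n * t ^ 2 := by
    have h1 : (p : ℝ) = n * √((p : ℝ) / n) ^ 2 := by rw [hr2]; field_simp
    rw [htdef]
    nlinarith [mul_nonneg (mul_nonneg hn'.le hr.le) hε₀]
  have ht3 : t ^ 2 ≤ 2 * (p / n + ε ^ 2) := by
    rw [htdef]
    nlinarith [sq_nonneg (√((p : ℝ) / n) - ε)]
  obtain ⟨w, hw⟩ := exists_norm_eq_one hp
  have hPprob := (hP.exists_projection_eq hh hS hp hw).1
  have hcont := isProbabilityMeasure_contaminate hε₀ hε₁ P Q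
  obtain ⟨E, hE, hPE, hdev⟩ := exists_uniform_deviation σ (contaminate ε P Q) hn hp ht
    (by nlinarith [mul_nonneg hn'.le (sq_nonneg ε)])
  refine ⟨E, hE, le_trans ?_ hPE, ?_⟩
  · rw [one_mul]
    exact sub_le_sub_left (Real.exp_le_exp.2 (by linarith)) _
  rintro x hx θ' ⟨S', hS', h', hh', P', hP', hmin⟩
  have hP'prob := (hP'.exists_projection_eq hh' hS' hp hw).1
  have hσ := σ.measurable_fn
  have hdevP : ∀ (u : EuclideanSpace ℝ (Fin p)) (b : ℝ),
      |1 / (n : ℝ) * ∑ i, σ.fn (inner ℝ u (x i) + b) - ∫ y, σ.fn (inner ℝ u y + b) ∂P| ≤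
        161 * t := by
    intro u b
    have h1 := hdev x hx u b
    have h2 := abs_integral_contaminate_sub_le hε₀ hε₁ P Q
      (f := fun y => σ.fn (inner ℝ u y + b)) (by fun_prop) (fun _ => σ.fn_nonneg _)
      fun _ => σ.fn_le_one _
    have h3 := abs_sub_le (1 / (n : ℝ) * ∑ i, σ.fn (inner ℝ u (x i) + b))
      (∫ y, σ.fn (inner ℝ u y + b) ∂(contaminate ε P Q)) (∫ y, σ.fn (inner ℝ u y + b) ∂P)
    linarith
  have hdevP' : ∀ (u : EuclideanSpace ℝ (Fin p)) (b : ℝ),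
      |1 / (n : ℝ) * ∑ i, σ.fn (inner ℝ u (x i) + b) - ∫ y, σ.fn (inner ℝ u y + b) ∂P'| ≤
        161 * t + 3 * K * t := by
    intro u b
    have h1 := le_jsCriterion σ hn hκ P' x u b
    have h2 := jsCriterion_le σ hn hκ P x (by positivity) hdevP
    have h3 := hmin θ S hS h hh P hP
    refine le_of_mul_le_mul_left ?_ hκ
    nlinarith [mul_le_mul_of_nonneg_left hκK hκ.le, mul_pos (mul_pos hκ hK) ht]
  have hclose : ∀ (u : EuclideanSpace ℝ (Fin p)) (b : ℝ),
      |∫ y, σ.fn (inner ℝ u y + b) ∂P - ∫ y, σ.fn (inner ℝ u y + b) ∂P'| ≤ B * t := by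
    intro u b
    have h1 := abs_sub_le (∫ y, σ.fn (inner ℝ u y + b) ∂P)
      (1 / (n : ℝ) * ∑ i, σ.fn (inner ℝ u (x i) + b)) (∫ y, σ.fn (inner ℝ u y + b) ∂P')
    rw [abs_sub_comm] at h1
    rw [abs_sub_comm (∫ y, σ.fn (inner ℝ u y + b) ∂P)] at h1
    rw [abs_sub_comm]
    linarith [hdevP u b, hdevP' u b]
  have hsmall : B * t ≤ δ₀ := by
    rw [mul_comm, ← le_div_iff₀ hBpos]
    exact abs_le_of_sq_le_sq' (by linarith) (by positivity) |>.2
  have hfin := hident p hp θ θ' S hS S' hS' h hh h' hh' P P' hP hP' (B * t) (by positivity) hsmall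
    hclose
  calc ‖θ' - θ‖ ^ 2 ≤ (C₀ * (B * t)) ^ 2 := by gcongr
    _ = (C₀ * B) ^ 2 * t ^ 2 := by ring
    _ ≤ (C₀ * B) ^ 2 * (4 * max ((p : ℝ) / n) (ε ^ 2)) := by
      gcongr
      linarith [le_max_left ((p : ℝ) / n) (ε ^ 2), le_max_right ((p : ℝ) / n) (ε ^ 2)]
    _ = _ := by ring
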